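/- **Setting.** Let $H=H^2(\mathbb R^4)$ be the completion of the real-valued Schwartz space $\mathcal S(\mathbb R^4)$ under $(f_1,f_2)_H=\int_{\mathbb R^4}(I-\Delta)^2f_1(x)\,f_2(x)\,dx$. Let $\Theta$ be a separable real Banach space into which $H$ is continuously and injectively embedded as a dense subspace, and let $\mathcal W$ be a Borel probability measure on $\Theta$ such that $\mathbb E^{\mathcal W}[e^{i\langle\cdot,x^*\rangle}]=e^{-\|h_{x^*}\|_H^2/2}$ for all $x^*\in\Theta^*$, where $h_{x^*}\in H$ is determined by $(h,h_{x^*})_H=\langle h,x^*\rangle$ for all $h\in H$ (that is, $(H,\Theta,\mathcal W)$ is an abstract Wiener space). Let $\mathcal I:H\to L^2(\mathcal W)$ be the Paley–Wiener map, i.e. the unique continuous linear extension of $h_{x^*}\mapsto\langle\cdot,x^*\rangle$ (a linear isometry). Let $H^{-2}$ be the space of real tempered distributions $\nu$ that are bounded for the norm of $H$ (the dual of $H$), and for $\nu\in H^{-2}$ let $h_\nu=(I-\Delta)^{-2}\nu\in H$ be the unique element with $(h,h_\nu)_H=\langle h,\nu\rangle$ for all $h\in H$. For $x\in\mathbb R^4$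 and $\epsilon>0$ let $\sigma^x_\epsilon$ and $d\sigma^x_\epsilon$ be the tempered distributions $$\langle f,\sigma_\epsilon^x\rangle=\frac1{2\pi^2\epsilon^3}\int_{S_\epsilon(x)}f\,d\sigma,\qquad \langle f,d\sigma^x_\epsilon\rangle=\frac{d}{d\epsilon}\langle f,\sigma^x_\epsilon\rangle\qquad(f\in\mathcal S(\mathbb R^4)),$$ where $S_\epsilon(x)$ is the sphere of radius $\epsilon$ about $x$ and $d\sigma$ its surface measure. With $I_k,K_k$ the modified Bessel functions, put $$\mathbf B(r)=\begin{pmatrix}I_1(r)/r&I_1'(r)\\ I_2(r)/r&I_1''(r)\end{pmatrix},\qquad \mu^x_\epsilon=(1,1)\,\mathbf B(\epsilon)^{-1}\begin{pmatrix}\sigma^x_\epsilon\\ d\sigma^x_\epsilon\end{pmatrix},$$ $$G(r)=-\frac1{4\pi^2}\cdot\frac{2I_1(r)K_1(r)+2I_2(r)K_0(r)-1}{I_1^2(r)-I_0(r)I_2(r)}\qquad(r>0).$$ **Theorem.** $G(r)>0$ for all $r>0$; $\mu^x_\epsilon\in H^{-2}$ for all $x\in\mathbb R^4$, $\epsilon>0$;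 and $\{\mathcal I(h_{\mu^x_\epsilon}):x\in\mathbb R^4,\ \epsilon>0\}$ is a centered Gaussian family under $\mathcal W$ such that: 1. For $x\in\mathbb R^4$ and $\epsilon_1\ge\epsilon_2>0$, $$\mathbb E^{\mathcal W}\big[\mathcal I(h_{\mu^x_{\epsilon_1}})\,\mathcal I(h_{\mu^x_{\epsilon_2}})\big]=\mathbb E^{\mathcal W}\big[\mathcal I(h_{\mu^x_{\epsilon_1}})^2\big]=G(\epsilon_1),$$ and $\mathcal I(h_{\mu^x_{\epsilon_2}})-\mathcal I(h_{\mu^x_{\epsilon_1}})$ is independent of the $\sigma$-algebra generated by $\{\mathcal I(h_{\mu^x_\eta}):\eta\ge\epsilon_1\}$ (independent reversed increments). 2. For $x\ne y$ in $\mathbb R^4$ and $\epsilon_1,\epsilon_2>0$ with $\epsilon_1>|x-y|+\epsilon_2$, $$\mathbb E^{\mathcal W}\big[\mathcal I(h_{\mu^x_{\epsilon_1}})\,\mathcal I(h_{\mu^y_{\epsilon_2}})\big]=I_0(|x-y|)\,G(\epsilon_1)-\frac1{4\pi^2}\cdot\frac{I_2(|x-y|)}{I_1^2(\epsilon_1)-I_0(\epsilon_1)I_2(\epsilon_1)}.$$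 3. For $x\ne y$ in $\mathbb R^4$ and $\epsilon_1,\epsilon_2>0$ with $|x-y|>\epsilon_1+\epsilon_2$, $$\mathbb E^{\mathcal W}\big[\mathcal I(h_{\mu^x_{\epsilon_1}})\,\mathcal I(h_{\mu^y_{\epsilon_2}})\big]=\frac1{2\pi^2}K_0(|x-y|).$$ -/

import Mathlib

open MeasureTheory ProbabilityTheory
open scoped SchwartzMap Laplacian LineDeriv Real

noncomputable section

namespace GFF

/-! ### Modified Bessel functions of integer order -/

/-- The modified Bessel function of the first kind `I_n`, by its power series
`I_n(r) = ∑ₘ (r/2)^(2m+n) / (m! (m+n)!)`. -/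
def besselI (n : ℕ) (r : ℝ) : ℝ :=
  ∑' m : ℕ, (r / 2) ^ (2 * m + n) / ((m.factorial : ℝ) * ((m + n).factorial : ℝ))

/-- The modified Bessel function of the second kind `K_n`, for `r > 0`, by its integral
representation `K_n(r) = ∫₀^∞ exp(-r cosh t) cosh(n t) dt`. -/
def besselK (n : ℕ) (r : ℝ) : ℝ :=
  ∫ t in Set.Ioi (0 : ℝ), Real.exp (-(r * Real.cosh t)) * Real.cosh ((n : ℝ) * t)

/-- The function `G`. -/
def G (r : ℝ) : ℝ :=
  (-(1 / (4 * π ^ 2))) *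
    ((2 * besselI 1 r * besselK 1 r + 2 * besselI 2 r * besselK 0 r - 1) /
      (besselI 1 r ^ 2 - besselI 0 r * besselI 2 r))

/-- The matrix `B(r)` with rows `(I₁(r)/r, I₁'(r))` and `(I₂(r)/r, I₁''(r))`. -/
def matB (r : ℝ) : Matrix (Fin 2) (Fin 2) ℝ :=
  !![besselI 1 r / r, deriv (besselI 1) r;
     besselI 2 r / r, deriv (deriv (besselI 1)) r]

/-! ### The Sobolev space `H²(ℝ⁴)` -/

/-- Euclidean space `ℝ⁴`. -/
abbrev E4 : Type := EuclideanSpace ℝ (Fin 4)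

/-- The operator `I - Δ` on real-valued Schwartz functions. -/
def oneSubLaplacian (f : 𝓢(E4, ℝ)) : 𝓢(E4, ℝ) := f - Δ f

/-- `∫ ((I - Δ)² f₁)(x) f₂(x) dx`. -/
def sobolevInner (f₁ f₂ : 𝓢(E4, ℝ)) : ℝ :=
  ∫ x, oneSubLaplacian (oneSubLaplacian f₁) x * f₂ x

lemma laplacian_add' (f g : 𝓢(E4, ℝ)) : Δ (f + g) = Δ f + Δ g := by
  simp only [← SchwartzMap.laplacianCLM_eq', map_add]

lemma laplacian_smul' (c : ℝ) (f : 𝓢(E4, ℝ)) : Δ (c • f) = c • Δ f := by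
  simp only [← SchwartzMap.laplacianCLM_eq', map_smul]

lemma oneSubLaplacian_add (f g : 𝓢(E4, ℝ)) :
    oneSubLaplacian (f + g) = oneSubLaplacian f + oneSubLaplacian g := by
  simp only [oneSubLaplacian, laplacian_add']; abel

lemma oneSubLaplacian_smul (c : ℝ) (f : 𝓢(E4, ℝ)) :
    oneSubLaplacian (c • f) = c • oneSubLaplacian f := by
  simp only [oneSubLaplacian, laplacian_smul', smul_sub]

lemma integrable_mul_schwartz (f g : 𝓢(E4, ℝ)) : Integrable (fun x => f x * g x) :=
  (SchwartzMap.bilinLeftCLM (ContinuousLinearMap.mul ℝ ℝ) g.hasTemperateGrowth f).integrable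

lemma integral_oneSubLaplacian_mul (f g : 𝓢(E4, ℝ)) :
    ∫ x, oneSubLaplacian f x * g x = ∫ x, f x * oneSubLaplacian g x := by
  have h := SchwartzMap.integral_mul_laplacian_right_eq_left (μ := volume) f g
  simp only [oneSubLaplacian, sub_apply, sub_mul, mul_sub]
  rw [integral_sub (integrable_mul_schwartz _ _) (integrable_mul_schwartz _ _),
    integral_sub (integrable_mul_schwartz _ _) (integrable_mul_schwartz _ _), h]

lemma sobolevInner_eq (f g : 𝓢(E4, ℝ)) :
    sobolevInner f g = ∫ x, oneSubLaplacian f x * oneSubLaplacian g x :=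
  integral_oneSubLaplacian_mul _ _

lemma integral_mul_laplacian_nonpos (f : 𝓢(E4, ℝ)) : ∫ x, f x * (Δ f) x ≤ 0 := by
  have h : ∀ x, f x * (Δ f) x =
      ∑ i, f x * (∂_{stdOrthonormalBasis ℝ E4 i} (∂_{stdOrthonormalBasis ℝ E4 i} f)) x := by
    intro x
    rw [SchwartzMap.laplacian_eq_sum (stdOrthonormalBasis ℝ E4), sum_apply,
      Finset.mul_sum]
  simp_rw [h]
  rw [integral_finsetSum _ (fun i _ => integrable_mul_schwartz _ _)]
  refine Finset.sum_nonpos fun i _ => ?_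
  rw [SchwartzMap.integral_mul_lineDerivOp_right_eq_neg_left]
  exact neg_nonpos.2 (integral_nonneg fun x => mul_self_nonneg _)

lemma eq_zero_of_sobolevInner_self (f : 𝓢(E4, ℝ)) (h : sobolevInner f f = 0) : f = 0 := by
  have key : ∀ g : 𝓢(E4, ℝ), ∫ x, g x * g x = 0 → g = 0 := by
    intro g hg
    have h0 := (integral_eq_zero_iff_of_nonneg (fun x => mul_self_nonneg (g x))
      (integrable_mul_schwartz g g)).1 hg
    have h1 := (Continuous.ae_eq_iff_eq volume (f := fun x => g x * g x) (g := 0)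
      (by fun_prop) continuous_const).1 h0
    ext x
    exact mul_self_eq_zero.1 (congrFun h1 x)
  rw [sobolevInner_eq] at h
  have h2 : ∀ x, f x = (Δ f) x := fun x => by
    have := congrArg (fun g : 𝓢(E4, ℝ) => g x) (key _ h)
    simpa [oneSubLaplacian, sub_eq_zero] using this
  refine key f (le_antisymm ?_ (integral_nonneg fun x => mul_self_nonneg _))
  refine le_trans (le_of_eq (integral_congr_ae (.of_forall fun x => ?_)))
    (integral_mul_laplacian_nonpos f)
  simp only [← h2 x]

lemma sobolevInner_comm (f g : 𝓢(E4, ℝ)) : sobolevInner g f = sobolevInner f g := by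
  rw [sobolevInner_eq, sobolevInner_eq]
  simp only [mul_comm]

lemma sobolevInner_self_nonneg (f : 𝓢(E4, ℝ)) : 0 ≤ sobolevInner f f := by
  rw [sobolevInner_eq]
  exact integral_nonneg fun x => mul_self_nonneg _

lemma sobolevInner_add_left (f₁ f₂ g : 𝓢(E4, ℝ)) :
    sobolevInner (f₁ + f₂) g = sobolevInner f₁ g + sobolevInner f₂ g := by
  simp only [sobolevInner, oneSubLaplacian_add, add_apply, add_mul]
  exact integral_add (integrable_mul_schwartz _ _) (integrable_mul_schwartz _ _)

lemma sobolevInner_smul_left (r : ℝ) (f g : 𝓢(E4, ℝ)) :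
    sobolevInner (r • f) g = r * sobolevInner f g := by
  simp only [sobolevInner, oneSubLaplacian_smul, smul_apply, smul_eq_mul, mul_assoc]
  exact integral_const_mul _ _

/-- The real-valued Schwartz space `𝓢(ℝ⁴)`, to be equipped with the inner product
`(f₁, f₂) = ∫ (I - Δ)² f₁ · f₂` instead of its usual topology. -/
def SchwartzH2 : Type := 𝓢(E4, ℝ)

instance : AddCommGroup SchwartzH2 := inferInstanceAs (AddCommGroup 𝓢(E4, ℝ))

instance : Module ℝ SchwartzH2 := inferInstanceAs (Module ℝ 𝓢(E4, ℝ))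

/-- `sobolevInner` is an inner product on `𝓢(ℝ⁴)`. -/
@[reducible] def sobolevCore : InnerProductSpace.Core ℝ SchwartzH2 where
  inner f g := sobolevInner f g
  conj_inner_symm f g := sobolevInner_comm f g
  re_inner_nonneg f := sobolevInner_self_nonneg f
  add_left f₁ f₂ g := sobolevInner_add_left f₁ f₂ g
  smul_left f g r := sobolevInner_smul_left r f g
  definite f h := eq_zero_of_sobolevInner_self f h

instance : NormedAddCommGroup SchwartzH2 := sobolevCore.toNormedAddCommGroup

instance : InnerProductSpace ℝ SchwartzH2 := InnerProductSpace.ofCore sobolevCore.toCore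

/-- The Sobolev space `H = H²(ℝ⁴)`: the Hilbert space completion of the real-valued Schwartz space
under the inner product `(f₁, f₂) = ∫ (I - Δ)² f₁ · f₂`. -/
abbrev H2 : Type := UniformSpace.Completion SchwartzH2

/-- The inclusion of `𝓢(ℝ⁴)` into `H²(ℝ⁴)`. -/
def toH2 : 𝓢(E4, ℝ) →ₗ[ℝ] H2 where
  toFun f := ((show SchwartzH2 from f : SchwartzH2) : H2)
  map_add' f g := UniformSpace.Completion.coe_add (α := SchwartzH2) f g
  map_smul' c f := UniformSpace.Completion.coe_smul (X := SchwartzH2) c f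

lemma inner_toH2 (f g : 𝓢(E4, ℝ)) :
    inner ℝ (toH2 f) (toH2 g) = ∫ x, oneSubLaplacian (oneSubLaplacian f) x * g x :=
  UniformSpace.Completion.inner_coe (𝕜 := ℝ) (E := SchwartzH2) f g

lemma denseRange_toH2 : DenseRange toH2 :=
  UniformSpace.Completion.denseRange_coe (α := SchwartzH2)

/-! ### The dual space `H⁻²(ℝ⁴)` -/

/-- Real tempered distributions on `ℝ⁴`. -/
abbrev TempDist : Type := 𝓢(E4, ℝ) →L[ℝ] ℝ

/-- `ν ∈ H⁻²(ℝ⁴)`: the tempered distribution `ν` is bounded for the `H²` norm, that is, it belongs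
to the dual of `H²(ℝ⁴)`. (Equivalently `∫ (1 + |ξ|²)⁻² |ν̂(ξ)|² dξ < ∞`.) -/
def MemHNegTwo (ν : TempDist) : Prop :=
  ∃ C : ℝ, ∀ f : 𝓢(E4, ℝ), |ν f| ≤ C * ‖toH2 f‖

/-- `h_ν = (I - Δ)⁻² ν` for `ν ∈ H⁻²`: the unique element of `H` such that
`(h, h_ν)_H = ⟨h, ν⟩` for all `h ∈ H`, where `⟨·, ν⟩` is extended from `𝓢(ℝ⁴)` to `H` by
continuity. -/
def hRep (ν : TempDist) : H2 :=
  (InnerProductSpace.toDual ℝ H2).symm (ν.toLinearMap.extendOfNorm toH2)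

lemma inner_hRep {ν : TempDist} (hν : MemHNegTwo ν) (f : 𝓢(E4, ℝ)) :
    inner ℝ (toH2 f) (hRep ν) = ν f := by
  rw [real_inner_comm, hRep, InnerProductSpace.toDual_symm_apply]
  exact LinearMap.extendOfNorm_eq (f := ν.toLinearMap) (e := toH2) denseRange_toH2 hν f

/-! ### Spherical averages and their radial derivatives -/

/-- The average of `f` over the sphere `S_ε(x)`. Here `volume.toSphere` is the surface measure of
the unit sphere of `ℝ⁴`, of total mass `2π²`, and the substitution `y = x + εω` turns
`(2π²ε³)⁻¹ ∫_{S_ε(x)} f dσ` into `(2π²)⁻¹ ∫_{S_1(0)} f(x + εω) dσ(ω)`. -/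
def sphericalAverage (x : E4) (ε : ℝ) (f : E4 → ℝ) : ℝ :=
  (1 / (2 * π ^ 2)) *
    ∫ ω : Metric.sphere (0 : E4) 1, f (x + ε • (ω : E4)) ∂(volume : Measure E4).toSphere

lemma integrable_sphere (x : E4) (ε : ℝ) (f : 𝓢(E4, ℝ)) :
    Integrable (fun ω : Metric.sphere (0 : E4) 1 => f (x + ε • (ω : E4)))
      (volume : Measure E4).toSphere := by
  refine Integrable.of_bound (C := SchwartzMap.seminorm ℝ 0 0 f) ?_
    (.of_forall fun ω => SchwartzMap.norm_le_seminorm ℝ f _)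
  exact Continuous.aestronglyMeasurable (by fun_prop)

lemma norm_fderiv_le_seminorm (f : 𝓢(E4, ℝ)) (y : E4) :
    ‖fderiv ℝ f y‖ ≤ SchwartzMap.seminorm ℝ 0 1 f := by
  rw [← norm_iteratedFDeriv_one]
  exact SchwartzMap.norm_iteratedFDeriv_le_seminorm ℝ f 1 y

lemma hasDerivAt_sphericalAverage (x : E4) (ε : ℝ) (f : 𝓢(E4, ℝ)) :
    HasDerivAt (fun r => sphericalAverage x r f)
      ((1 / (2 * π ^ 2)) * ∫ ω : Metric.sphere (0 : E4) 1,
        fderiv ℝ f (x + ε • (ω : E4)) (ω : E4) ∂(volume : Measure E4).toSphere) ε := by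
  refine HasDerivAt.const_mul _ ?_
  have hc : Continuous (fderiv ℝ f) := (f.smooth 1).continuous_fderiv (by norm_num)
  refine (hasDerivAt_integral_of_dominated_loc_of_deriv_le (s := Set.univ)
    (F := fun (r : ℝ) (ω : Metric.sphere (0 : E4) 1) => f (x + r • (ω : E4)))
    (F' := fun (r : ℝ) (ω : Metric.sphere (0 : E4) 1) => fderiv ℝ f (x + r • (ω : E4)) (ω : E4))
    (bound := fun _ => SchwartzMap.seminorm ℝ 0 1 f) Filter.univ_mem
    (.of_forall fun r => (integrable_sphere x r f).aestronglyMeasurable)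
    (integrable_sphere x ε f) ?_ (.of_forall fun ω r _ => ?_) (integrable_const _)
    (.of_forall fun ω r _ => ?_)).2
  · refine Continuous.aestronglyMeasurable ?_
    exact (hc.comp (by fun_prop)).clm_apply continuous_subtype_val
  · refine ((fderiv ℝ f (x + r • (ω : E4))).le_opNorm _).trans ?_
    have : ‖(ω : E4)‖ = 1 := by simp
    rw [this, mul_one]
    exact norm_fderiv_le_seminorm f _
  · have h1 : HasFDerivAt f (fderiv ℝ f (x + r • (ω : E4))) (x + r • (ω : E4)) :=
      f.differentiableAt.hasFDerivAt
    have h2 : HasDerivAt (fun s : ℝ => x + s • (ω : E4)) ((1 : ℝ) • (ω : E4)) r :=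
      ((hasDerivAt_id r).smul_const (ω : E4)).const_add x
    rw [one_smul] at h2
    exact h1.comp_hasDerivAt r h2

/-- The tempered distribution `σ^x_ε`: `⟨f, σ^x_ε⟩` is the average of `f` over `S_ε(x)`. -/
def sigmaDist (x : E4) (ε : ℝ) : TempDist :=
  SchwartzMap.mkCLMtoNormedSpace (σ := RingHom.id ℝ) (fun f => sphericalAverage x ε f)
    (fun f g => by
      simp only [sphericalAverage, add_apply]
      rw [integral_add (integrable_sphere x ε f) (integrable_sphere x ε g), mul_add])
    (fun c f => by
      simp only [sphericalAverage, smul_apply, RingHom.id_apply, smul_eq_mul]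
      rw [integral_const_mul]; ring)
    ⟨{(0, 0)}, |1 / (2 * π ^ 2)| * (volume : Measure E4).toSphere.real Set.univ, by positivity,
      fun f => by
        simp only [sphericalAverage, norm_mul, Real.norm_eq_abs, mul_assoc]
        refine mul_le_mul_of_nonneg_left ?_ (abs_nonneg _)
        rw [mul_comm]
        simpa using norm_integral_le_of_norm_le_const
          (μ := (volume : Measure E4).toSphere)
          (f := fun ω : Metric.sphere (0 : E4) 1 => f (x + ε • (ω : E4)))
          (.of_forall fun ω => SchwartzMap.norm_le_seminorm ℝ f (x + ε • (ω : E4)))⟩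

/-- The tempered distribution `dσ^x_ε`: `⟨f, dσ^x_ε⟩ = d/dε ⟨f, σ^x_ε⟩`. -/
def dsigmaDist (x : E4) (ε : ℝ) : TempDist :=
  SchwartzMap.mkCLMtoNormedSpace (σ := RingHom.id ℝ) (fun f => deriv (fun r => sigmaDist x r f) ε)
    (fun f g => by
      simp only [map_add]
      exact deriv_fun_add (hasDerivAt_sphericalAverage x ε f).differentiableAt
        (hasDerivAt_sphericalAverage x ε g).differentiableAt)
    (fun c f => by
      simp only [map_smul, RingHom.id_apply, smul_eq_mul]
      exact deriv_const_mul c (hasDerivAt_sphericalAverage x ε f).differentiableAt)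
    ⟨{(0, 1)}, |1 / (2 * π ^ 2)| * (volume : Measure E4).toSphere.real Set.univ, by positivity,
      fun f => by
        have h := (hasDerivAt_sphericalAverage x ε f).deriv
        change ‖deriv (fun r => sphericalAverage x r f) ε‖ ≤ _
        rw [h]
        simp only [norm_mul, Real.norm_eq_abs, mul_assoc]
        refine mul_le_mul_of_nonneg_left ?_ (abs_nonneg _)
        rw [mul_comm]
        simpa using norm_integral_le_of_norm_le_const
          (μ := (volume : Measure E4).toSphere) (C := SchwartzMap.seminorm ℝ 0 1 f)
          (f := fun ω : Metric.sphere (0 : E4) 1 => fderiv ℝ f (x + ε • (ω : E4)) (ω : E4))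
          (.of_forall fun ω => by
            refine ((fderiv ℝ f (x + ε • (ω : E4))).le_opNorm _).trans ?_
            have : ‖(ω : E4)‖ = 1 := by simp
            rw [this, mul_one]
            exact norm_fderiv_le_seminorm f _)⟩

/-- `μ^x_ε = ζᵀ B(ε)⁻¹ (σ^x_ε, dσ^x_ε)ᵀ` with `ζ = (1, 1)ᵀ`. -/
def muDist (x : E4) (ε : ℝ) : TempDist :=
  let c : Fin 2 → ℝ := Matrix.vecMul ![1, 1] (matB ε)⁻¹
  c 0 • sigmaDist x ε + c 1 • dsigmaDist x ε

/-! ### Abstract Wiener spaces and Paley-Wiener integrals -/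

section Wiener

variable {H Θ : Type*} [NormedAddCommGroup H] [InnerProductSpace ℝ H] [CompleteSpace H]
  [NormedAddCommGroup Θ] [NormedSpace ℝ Θ]

/-- For a bounded linear functional `x*` on `Θ`, the unique `h_{x*} ∈ H` such that
`(h, h_{x*})_H = ⟨h, x*⟩` for all `h ∈ H`, where `H` is embedded into `Θ` through `ι`. -/
def dualRep (ι : H →L[ℝ] Θ) : StrongDual ℝ Θ →ₗ[ℝ] H where
  toFun L := (InnerProductSpace.toDual ℝ H).symm (L.comp ι)
  map_add' L L' := by simp [ContinuousLinearMap.add_comp]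
  map_smul' c L := by simp [ContinuousLinearMap.smul_comp]

lemma inner_dualRep (ι : H →L[ℝ] Θ) (L : StrongDual ℝ Θ) (h : H) :
    inner ℝ h (dualRep ι L) = L (ι h) := by
  rw [real_inner_comm]
  exact InnerProductSpace.toDual_symm_apply

/-- `(H, Θ, W)` is an abstract Wiener space: `Θ` is a separable Banach space with its Borel
`σ`-algebra, the Hilbert space `H` is embedded into `Θ` by the injective continuous linear map `ι`
with dense range, and `W` is a probability measure with
`𝔼^W[exp(i⟨·, x*⟩)] = exp(-‖h_{x*}‖² / 2)` for all `x* ∈ Θ*`. -/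
structure IsAbstractWienerSpace [CompleteSpace Θ] [TopologicalSpace.SeparableSpace Θ]
    [MeasurableSpace Θ] [BorelSpace Θ] (ι : H →L[ℝ] Θ) (W : Measure Θ) : Prop where
  isProbabilityMeasure : IsProbabilityMeasure W
  injective : Function.Injective ι
  denseRange : DenseRange ι
  integral_exp : ∀ L : StrongDual ℝ Θ,
    ∫ θ, Complex.exp (Complex.I * (L θ : ℂ)) ∂W = Complex.exp (-((‖dualRep ι L‖ ^ 2 / 2 : ℝ) : ℂ))

/-- The Paley-Wiener map `𝓘 : H → L²(W)`: the continuous extension of `h_{x*} ↦ ⟨·, x*⟩`. -/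
def paleyWiener [MeasurableSpace Θ] [BorelSpace Θ] (ι : H →L[ℝ] Θ) (W : Measure Θ) : H →L[ℝ] Lp ℝ 2 W :=
  (StrongDual.toLp (𝕜 := ℝ) W 2).toLinearMap.extendOfNorm (dualRep ι)

lemma denseRange_dualRep {ι : H →L[ℝ] Θ} (hι : Function.Injective ι) : DenseRange (dualRep ι) := by
  have h : (LinearMap.range (dualRep ι)).topologicalClosure = ⊤ := by
    rw [Submodule.topologicalClosure_eq_top_iff, Submodule.eq_bot_iff]
    intro h hh
    refine hι ?_
    rw [map_zero]
    refine SeparatingDual.eq_zero_of_forall_dual_eq_zero (R := ℝ) fun L => ?_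
    rw [← inner_dualRep ι L h, real_inner_comm]
    exact (Submodule.mem_orthogonal _ _).1 hh _ (LinearMap.mem_range_self _ L)
  have h' := (Submodule.dense_iff_topologicalClosure_eq_top).2 h
  rwa [LinearMap.coe_range] at h'

section

variable [CompleteSpace Θ] [TopologicalSpace.SeparableSpace Θ] [MeasurableSpace Θ] [BorelSpace Θ]
  {ι : H →L[ℝ] Θ} {W : Measure Θ}

lemma IsAbstractWienerSpace.map_eq (hW : IsAbstractWienerSpace ι W) (L : StrongDual ℝ Θ) :
    W.map L = gaussianReal 0 (‖dualRep ι L‖₊ ^ 2) := by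
  have := hW.isProbabilityMeasure
  have : IsProbabilityMeasure (W.map L) := Measure.isProbabilityMeasure_map (by fun_prop)
  refine Measure.ext_of_charFun ?_
  ext t
  have h := hW.integral_exp (t • L)
  rw [charFun_gaussianReal, charFun_apply_real, integral_map (by fun_prop) (by fun_prop)]
  refine Eq.trans (integral_congr_ae (.of_forall fun θ => ?_)) (h.trans ?_)
  · simp; ring_nf
  · congr 1
    rw [map_smul, norm_smul, mul_pow, Real.norm_eq_abs, sq_abs]
    push_cast
    simp
    ring

lemma IsAbstractWienerSpace.memLp (hW : IsAbstractWienerSpace ι W) : MemLp id 2 W := by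
  have : SecondCountableTopology Θ := UniformSpace.secondCountable_of_separable Θ
  have : IsGaussian W := isGaussian_of_map_eq_gaussianReal fun L => ⟨_, _, hW.map_eq L⟩
  exact IsGaussian.memLp_id W 2 (by simp)

lemma IsAbstractWienerSpace.norm_toLp (hW : IsAbstractWienerSpace ι W) (L : StrongDual ℝ Θ) :
    ‖StrongDual.toLp (𝕜 := ℝ) W 2 L‖ = ‖dualRep ι L‖ := by
  rw [← sq_eq_sq₀ (norm_nonneg _) (norm_nonneg _), ← real_inner_self_eq_norm_sq,
    StrongDual.toLp_apply hW.memLp, L2.inner_def]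
  have h2 : ∫ t, t ^ 2 ∂(W.map L) = ‖dualRep ι L‖ ^ 2 := by
    have := variance_id_gaussianReal (μ := 0) (v := ‖dualRep ι L‖₊ ^ 2)
    rw [variance_eq_integral (by fun_prop)] at this
    rw [hW.map_eq L]
    simpa using this
  rw [← h2, integral_map (by fun_prop) (by fun_prop)]
  refine integral_congr_ae ?_
  filter_upwards [MemLp.coeFn_toLp (hW.memLp.continuousLinearMap_comp L)] with θ hθ
  have hθ' : (MemLp.toLp (fun x => L (id x)) (hW.memLp.continuousLinearMap_comp L)) θ = L θ := hθ
  simp only [RCLike.inner_apply, conj_trivial, sq]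
  exact congrArg₂ (· * ·) hθ' hθ'

/-- On an abstract Wiener space `𝓘(h_{x*}) = ⟨·, x*⟩` almost surely. -/
lemma IsAbstractWienerSpace.paleyWiener_dualRep (hW : IsAbstractWienerSpace ι W)
    (L : StrongDual ℝ Θ) : paleyWiener ι W (dualRep ι L) =ᵐ[W] L := by
  have h : paleyWiener ι W (dualRep ι L) = StrongDual.toLp (𝕜 := ℝ) W 2 L :=
    LinearMap.extendOfNorm_eq (f := (StrongDual.toLp (𝕜 := ℝ) W 2).toLinearMap)
      (e := dualRep ι) (denseRange_dualRep hW.injective)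
      ⟨1, fun L => by simpa using (hW.norm_toLp L).le⟩ L
  rw [h, StrongDual.toLp_apply hW.memLp]
  exact MemLp.coeFn_toLp (hW.memLp.continuousLinearMap_comp L)

/-- On an abstract Wiener space `𝓘` is an isometry. -/
lemma IsAbstractWienerSpace.norm_paleyWiener (hW : IsAbstractWienerSpace ι W) (h : H) :
    ‖paleyWiener ι W h‖ = ‖h‖ := by
  refine (denseRange_dualRep hW.injective).induction_on (p := fun h => ‖paleyWiener ι W h‖ = ‖h‖) h
    (isClosed_eq (by fun_prop) (by fun_prop)) fun L => ?_
  rw [← hW.norm_toLp L]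
  congr 1
  exact LinearMap.extendOfNorm_eq (f := (StrongDual.toLp (𝕜 := ℝ) W 2).toLinearMap)
      (e := dualRep ι) (denseRange_dualRep hW.injective)
      ⟨1, fun L => by simpa using (hW.norm_toLp L).le⟩ L

end

end Wiener

/-- The random variable `𝓘(h_{μ^x_ε})`. -/
def muField {Θ : Type*} [NormedAddCommGroup Θ] [NormedSpace ℝ Θ] [MeasurableSpace Θ] [BorelSpace Θ]
    (ι : H2 →L[ℝ] Θ) (W : Measure Θ) (x : E4) (ε : ℝ) : Lp ℝ 2 W :=
  paleyWiener ι W (hRep (muDist x ε))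

end GFF

end

open GFF

/-!
The proof represents every `h_{μ^x_ε}` by an explicit function. Since `I - Δ` extends to an isometry
of `H²` onto `L²(ℝ⁴)`, a distribution `ν` lies in `H⁻²` as soon as `⟨f, ν⟩ = ∫ (I - Δ) f · w` for
some `w ∈ L²`; then `w` is the image of `h_ν`, and inner products in `H²` become integrals of
products of such functions (`inner_hRep_hRep`). The image of the Schwartz space is dense in `L²`
because `I - Δ` maps that space onto itself: it has the inverse Fourier multiplier `(1 + |2πξ|²)⁻¹`
(`oneSubLaplacian_surjective`).

For `μ^x_ε` the function `w` is `density x ε`: it is radial about `x`, a multiple of the regular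
solution `I_1(r)/r` of `Δ u = u` inside the sphere `S_ε(x)`, and `(2π²)⁻¹` times the decaying
solution `K_1(r)/r` outside. Up to sign and normalization, the coefficients in the definition of
`μ^x_ε` are the jumps of the normal derivative of this function and of the function itself across
the sphere (`profile_jump`). The spherical averages `A(r) = ⟨f, σ^x_r⟩` satisfy the Darboux
equation `(r³ A')' = r³ ⟨Δf, σ^x_r⟩` (`hasDerivAt_cube_mul_sphericalDeriv`), so in polar
coordinates Green's formula is a one-dimensional integration by parts and gives
`⟨f, μ^x_ε⟩ = ∫ (I - Δ) f · density x ε` (`muDist_eq_integral`).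

The covariances are then integrals of products of two densities. For concentric spheres they are
one-dimensional, with the explicit primitives `r² (I_1² - I_0 I_2)`, `r² (I_1 K_1 + I_2 K_0)` and
`r² (K_0 K_2 - K_1²)`, and `turan_identity`, a consequence of the Wronskian `bessel_wronskian`,
collects the terms into `G`. The choice of the interior coefficient makes
`density y ε₂ - (2π²)⁻¹ K_1(|z - y|)/|z - y|` orthogonal to every function that solves `Δ u = u` in
the ball of radius `ε₂` about `y` (`integral_mul_profile_eq`). For nested or disjoint balls
`density x ε₁` is such a function, so the second density may be replaced by the decaying solution
with pole `y`, and the mean value property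
`sphericalAverage_eq_of_laplacian_eq_on_ball` reduces the pairing to one dimension again.

On the probabilistic side, the Paley-Wiener integrals form a centered Gaussian process indexed by
`H²`, with the inner product as covariance (`isGaussianProcess_paleyWiener`,
`integral_paleyWiener_mul`). Independence of the increments is orthogonality in `H²`: for `η ≥ ε₁`
the covariances of `𝓘(h_{μ^x_η})` with `𝓘(h_{μ^x_{ε₁}})` and with `𝓘(h_{μ^x_{ε₂}})` are both `G η`
(`indep_paleyWiener_sub`).
-/

noncomputable section

namespace GFF

open Filter Topology Set

/-! ### Modified Bessel functions of the first kind -/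

/-- The entire function `S_n(w) = ∑ₘ w^m / (m! (m+n)!)`, for which
`I_n(r) = (r/2)^n S_n(r²/4)`. -/
def besselSeries (n : ℕ) (w : ℝ) : ℝ :=
  ∑' m : ℕ, w ^ m / ((m.factorial : ℝ) * ((m + n).factorial : ℝ))

lemma abs_besselSeries_term_le (n m : ℕ) {w R : ℝ} (hw : |w| ≤ R) :
    |w ^ m / ((m.factorial : ℝ) * ((m + n).factorial : ℝ))| ≤ R ^ m / (m.factorial : ℝ) := by
  rw [abs_div, abs_pow, abs_of_pos (by positivity : (0 : ℝ) < m.factorial * (m + n).factorial)]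
  have h1 : (1 : ℝ) ≤ ((m + n).factorial : ℝ) := by
    exact_mod_cast Nat.one_le_iff_ne_zero.2 (Nat.factorial_ne_zero _)
  have h0 : (0 : ℝ) < (m.factorial : ℝ) := by positivity
  have hR : 0 ≤ R := (abs_nonneg w).trans hw
  gcongr
  exact le_mul_of_one_le_right h0.le h1

lemma summable_besselSeries (n : ℕ) (w : ℝ) :
    Summable fun m : ℕ => w ^ m / ((m.factorial : ℝ) * ((m + n).factorial : ℝ)) :=
  .of_norm_bounded (Real.summable_pow_div_factorial |w|)
    fun m => abs_besselSeries_term_le n m le_rfl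

lemma hasDerivAt_besselSeries (n : ℕ) (w : ℝ) :
    HasDerivAt (besselSeries n) (besselSeries (n + 1) w) w := by
  set g' : ℕ → ℝ → ℝ := fun m y =>
    (m * y ^ (m - 1)) / ((m.factorial : ℝ) * ((m + n).factorial : ℝ)) with hg'
  have hsucc : ∀ m y, g' (m + 1) y =
      y ^ m / ((m.factorial : ℝ) * ((m + (n + 1)).factorial : ℝ)) := by
    intro m y
    have h : m + 1 + n = m + (n + 1) := by ring
    simp only [hg', h, Nat.factorial_succ m, Nat.add_sub_cancel]
    push_cast
    field_simp
  have hzero : ∀ y, g' 0 y = 0 := fun y => by simp [hg']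
  set R : ℝ := |w| + 1
  have hu : Summable fun m : ℕ =>
      if m = 0 then (0 : ℝ) else R ^ (m - 1) / ((m - 1).factorial : ℝ) := by
    rw [← summable_nat_add_iff 1]
    simpa using Real.summable_pow_div_factorial R
  have h := hasDerivAt_tsum_of_isPreconnected (t := Ioo (-R) R) (y₀ := w) (y := w)
    (g := fun m y => y ^ m / ((m.factorial : ℝ) * ((m + n).factorial : ℝ))) (g' := g')
    hu isOpen_Ioo isPreconnected_Ioo
    (fun m y _ => (hasDerivAt_pow m y).div_const _)
    (fun m y hy => ?_) (abs_lt.1 (lt_add_one _)) (summable_besselSeries n w)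
    (abs_lt.1 (lt_add_one _))
  · refine h.congr_deriv ?_
    have hs : Summable fun m => g' m w := by
      rw [← summable_nat_add_iff 1]
      simpa only [hsucc] using summable_besselSeries (n + 1) w
    rw [hs.tsum_eq_zero_add, hzero, zero_add]
    simp only [hsucc]
    rfl
  · rcases m with _ | m
    · simp [hzero]
    · rw [hsucc]
      simpa only [Nat.add_one_ne_zero, if_false, Nat.add_sub_cancel, Real.norm_eq_abs] using
        abs_besselSeries_term_le (n + 1) m (abs_lt.2 hy).le

/-- The power series form of the recurrence `I_n - I_{n+2} = (2(n+1)/r) I_{n+1}`. -/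
lemma besselSeries_recurrence (n : ℕ) (w : ℝ) :
    besselSeries n w = (n + 1) * besselSeries (n + 1) w + w * besselSeries (n + 2) w := by
  have h2 : w * besselSeries (n + 2) w =
      ∑' m : ℕ, m * (w ^ m / ((m.factorial : ℝ) * ((m + (n + 1)).factorial : ℝ))) := by
    have hs : ∀ m : ℕ, ((m + 1 : ℕ) : ℝ) *
        (w ^ (m + 1) / (((m + 1).factorial : ℝ) * ((m + 1 + (n + 1)).factorial : ℝ))) =
        w * (w ^ m / ((m.factorial : ℝ) * ((m + (n + 2)).factorial : ℝ))) := by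
      intro m
      have h : m + 1 + (n + 1) = m + (n + 2) := by ring
      rw [h, Nat.factorial_succ m, pow_succ]
      push_cast
      field_simp
    rw [Summable.tsum_eq_zero_add]
    · simp only [hs, tsum_mul_left]
      simp [besselSeries]
    · rw [← summable_nat_add_iff 1]
      simpa only [hs] using (summable_besselSeries (n + 2) w).mul_left w
  have hterm : ∀ m : ℕ, w ^ m / ((m.factorial : ℝ) * ((m + n).factorial : ℝ)) -
      (n + 1) * (w ^ m / ((m.factorial : ℝ) * ((m + (n + 1)).factorial : ℝ))) =
      m * (w ^ m / ((m.factorial : ℝ) * ((m + (n + 1)).factorial : ℝ))) := by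
    intro m
    rw [← add_assoc m n 1, Nat.factorial_succ (m + n)]
    push_cast
    field_simp
    ring
  rw [h2, ← sub_eq_iff_eq_add']
  simp only [← hterm]
  rw [(summable_besselSeries n w).tsum_sub ((summable_besselSeries (n + 1) w).mul_left _),
    tsum_mul_left]
  rfl

lemma besselI_eq (n : ℕ) (r : ℝ) : besselI n r = (r / 2) ^ n * besselSeries n (r ^ 2 / 4) := by
  rw [besselI, besselSeries, ← tsum_mul_left]
  refine tsum_congr fun m => ?_
  rw [pow_add, pow_mul]
  have : (r / 2) ^ 2 = r ^ 2 / 4 := by ring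
  rw [this]; ring

lemma contDiff_besselSeries (m : ℕ) : ∀ n : ℕ, ContDiff ℝ m (besselSeries n) := by
  have hd : ∀ n, deriv (besselSeries n) = besselSeries (n + 1) := fun n =>
    funext fun w => (hasDerivAt_besselSeries n w).deriv
  induction m with
  | zero => exact fun n => contDiff_zero.2 (continuous_iff_continuousAt.2
      fun w => (hasDerivAt_besselSeries n w).continuousAt)
  | succ m ih =>
    intro n
    push_cast
    refine contDiff_succ_iff_deriv.2 ⟨fun w => (hasDerivAt_besselSeries n w).differentiableAt,
      by simp, ?_⟩
    rw [hd]
    exact ih _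

lemma continuous_besselSeries (n : ℕ) : Continuous (besselSeries n) :=
  (contDiff_besselSeries 0 n).continuous

lemma besselSeries_pos (n : ℕ) {w : ℝ} (hw : 0 ≤ w) : 0 < besselSeries n w :=
  (summable_besselSeries n w).tsum_pos (fun m => by positivity) 0 (by positivity)

lemma besselSeries_one_zero : besselSeries 1 0 = 1 := by
  rw [besselSeries, tsum_eq_single 0 (fun m hm => by simp [hm])]; simp

lemma besselI_pos (n : ℕ) {r : ℝ} (hr : 0 < r) : 0 < besselI n r := by
  rw [besselI_eq]
  exact mul_pos (by positivity) (besselSeries_pos n (by positivity))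

lemma continuous_besselI (n : ℕ) : Continuous (besselI n) := by
  have := continuous_besselSeries n
  rw [show besselI n = fun r => (r / 2) ^ n * besselSeries n (r ^ 2 / 4) from
    funext (besselI_eq n)]
  fun_prop

lemma besselI_zero_zero : besselI 0 0 = 1 := by
  rw [besselI_eq, besselSeries, tsum_eq_single 0 (fun m hm => by simp [hm])]; simp

lemma besselI_succ_zero (n : ℕ) : besselI (n + 1) 0 = 0 := by
  rw [besselI_eq]; simp

/-- `I_n - I_{n+2} = (2(n+1)/r) I_{n+1}`, multiplied by `r`. -/
lemma besselI_recurrence (n : ℕ) (r : ℝ) :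
    r * besselI (n + 2) r = r * besselI n r - 2 * (n + 1) * besselI (n + 1) r := by
  rw [besselI_eq, besselI_eq, besselI_eq, besselSeries_recurrence n]
  ring

/-- `I_n' = I_{n+1} + (n/r) I_n`. -/
lemma hasDerivAt_besselI (n : ℕ) {r : ℝ} (hr : r ≠ 0) :
    HasDerivAt (besselI n) (besselI (n + 1) r + n / r * besselI n r) r := by
  rw [show besselI n = fun r => (r / 2) ^ n * besselSeries n (r ^ 2 / 4) from
    funext (besselI_eq n)]
  have h1 : HasDerivAt (fun r : ℝ => (r / 2) ^ n) (n * (r / 2) ^ (n - 1) * (1 / 2)) r :=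
    ((hasDerivAt_id r).div_const 2).pow n
  have h2 : HasDerivAt (fun r : ℝ => r ^ 2 / 4) (2 * r / 4) r := by
    simpa using (hasDerivAt_pow 2 r).div_const 4
  refine (h1.mul ((hasDerivAt_besselSeries n _).comp r h2)).congr_deriv ?_
  rw [besselI_eq]
  rcases n with _ | n
  · simp; ring
  · simp only [Nat.add_sub_cancel, Function.comp_apply]
    push_cast
    field_simp
    ring

lemma besselI_two_eq {r : ℝ} (hr : r ≠ 0) :
    besselI 2 r = besselI 0 r - 2 / r * besselI 1 r := by
  have h := besselI_recurrence 0 r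
  simp only [zero_add, Nat.cast_zero, mul_one] at h
  field_simp
  linarith

lemma hasDerivAt_besselI_zero {r : ℝ} (hr : r ≠ 0) :
    HasDerivAt (besselI 0) (besselI 1 r) r := by
  simpa using hasDerivAt_besselI 0 hr

lemma hasDerivAt_besselI_one {r : ℝ} (hr : r ≠ 0) :
    HasDerivAt (besselI 1) (besselI 0 r - besselI 1 r / r) r := by
  refine (hasDerivAt_besselI 1 hr).congr_deriv ?_
  rw [one_add_one_eq_two, besselI_two_eq hr]
  push_cast
  ring

lemma hasDerivAt_besselI_two {r : ℝ} (hr : r ≠ 0) :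
    HasDerivAt (besselI 2) (besselI 1 r - 2 / r * besselI 2 r) r := by
  refine (hasDerivAt_besselI 2 hr).congr_deriv ?_
  have h := besselI_recurrence 1 r
  norm_num at h ⊢
  field_simp
  linarith

/-! ### Modified Bessel functions of the second kind -/

lemma exp_neg_mul_cosh_mul_le (n : ℕ) {r t : ℝ} (hr : 0 < r) (ht : 0 ≤ t) :
    Real.exp (-(r * Real.cosh t)) * Real.cosh (n * t) ≤
      ((n + 1).factorial : ℝ) * (2 / r) ^ (n + 1) * Real.exp (-t) := by
  have hc : Real.exp t / 2 ≤ Real.cosh t := by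
    rw [Real.cosh_eq]; have := Real.exp_pos (-t); linarith
  have hcn : Real.cosh (n * t) ≤ Real.exp (n * t) := by
    rw [Real.cosh_eq]
    have : Real.exp (-(n * t)) ≤ Real.exp (n * t) := Real.exp_le_exp.2 (by
      have : 0 ≤ n * t := by positivity
      linarith)
    linarith
  have h1 := Real.pow_div_factorial_le_exp (r * (Real.exp t / 2)) (by positivity) (n + 1)
  have h2 : Real.exp (-(r * Real.cosh t)) ≤
      ((n + 1).factorial : ℝ) / (r * (Real.exp t / 2)) ^ (n + 1) := by
    rw [Real.exp_neg, ← inv_div]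
    refine inv_anti₀ (by positivity) (h1.trans (Real.exp_le_exp.2 ?_))
    gcongr
  calc _ ≤ ((n + 1).factorial : ℝ) / (r * (Real.exp t / 2)) ^ (n + 1) * Real.exp (n * t) := by
        gcongr
    _ = _ := by
        have h3 : Real.exp (n * t) = Real.exp t ^ n := by rw [← Real.exp_nat_mul]
        rw [h3, Real.exp_neg, mul_div_assoc', div_pow, div_pow, mul_pow]
        field_simp
        rw [pow_succ]

lemma integrableOn_besselK (n : ℕ) {r : ℝ} (hr : 0 < r) :
    IntegrableOn (fun t => Real.exp (-(r * Real.cosh t)) * Real.cosh (n * t)) (Ioi 0) := by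
  refine Integrable.mono' ((integrableOn_exp_neg_Ioi 0).const_mul
    (((n + 1).factorial : ℝ) * (2 / r) ^ (n + 1))) (by fun_prop) ?_
  filter_upwards [ae_restrict_mem measurableSet_Ioi] with t ht
  rw [Real.norm_of_nonneg (mul_nonneg (Real.exp_pos _).le (Real.cosh_pos _).le)]
  exact exp_neg_mul_cosh_mul_le n hr (le_of_lt ht)

lemma abs_sinh_le_cosh (t : ℝ) : |Real.sinh t| ≤ Real.cosh t := by
  rw [Real.sinh_eq, Real.cosh_eq, abs_le]
  have h1 := Real.exp_pos t
  have h2 := Real.exp_pos (-t)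
  constructor <;> linarith

lemma integrableOn_exp_mul_cosh_cosh (n : ℕ) {r : ℝ} (hr : 0 < r) :
    IntegrableOn (fun t => Real.exp (-(r * Real.cosh t)) * (Real.cosh t * Real.cosh (n * t)))
      (Ioi 0) := by
  refine ((integrableOn_besselK (n + 1) hr).const_mul 2).mono' (by fun_prop) ?_
  filter_upwards [ae_restrict_mem measurableSet_Ioi] with t ht
  have ht : 0 < t := ht
  have h1 : 0 < Real.cosh t * Real.cosh (n * t) := mul_pos (Real.cosh_pos _) (Real.cosh_pos _)
  have h2 : 0 ≤ Real.sinh t * Real.sinh (n * t) :=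
    mul_nonneg (Real.sinh_nonneg_iff.2 ht.le) (Real.sinh_nonneg_iff.2 (by positivity))
  rw [Real.norm_of_nonneg (mul_nonneg (Real.exp_pos _).le h1.le)]
  have h3 : Real.cosh (((n + 1 : ℕ) : ℝ) * t) =
      Real.cosh t * Real.cosh (n * t) + Real.sinh t * Real.sinh (n * t) := by
    push_cast
    rw [add_mul, one_mul, add_comm, Real.cosh_add]
  rw [h3]
  have h4 := mul_nonneg (Real.exp_pos (-(r * Real.cosh t))).le
    (by linarith : 0 ≤ Real.cosh t * Real.cosh (n * t) + 2 * (Real.sinh t * Real.sinh (n * t)))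
  linarith

lemma integrableOn_exp_mul_sinh_sinh (n : ℕ) {r : ℝ} (hr : 0 < r) :
    IntegrableOn (fun t => Real.exp (-(r * Real.cosh t)) * (Real.sinh t * Real.sinh (n * t)))
      (Ioi 0) := by
  refine (integrableOn_exp_mul_cosh_cosh n hr).mono' (by fun_prop) (.of_forall fun t => ?_)
  rw [norm_mul, Real.norm_of_nonneg (Real.exp_pos _).le, norm_mul]
  gcongr
  exacts [abs_sinh_le_cosh _, abs_sinh_le_cosh _]

lemma hasDerivAt_besselK_aux (n : ℕ) {r : ℝ} (hr : 0 < r) :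
    HasDerivAt (besselK n) (-∫ t in Ioi (0 : ℝ),
      Real.exp (-(r * Real.cosh t)) * (Real.cosh t * Real.cosh (n * t))) r := by
  rw [← integral_neg]
  refine (hasDerivAt_integral_of_dominated_loc_of_deriv_le (s := Ioi (r / 2))
    (F := fun r t => Real.exp (-(r * Real.cosh t)) * Real.cosh (n * t))
    (F' := fun r t => -(Real.exp (-(r * Real.cosh t)) * (Real.cosh t * Real.cosh (n * t))))
    (bound := fun t => Real.exp (-(r / 2 * Real.cosh t)) * (Real.cosh t * Real.cosh (n * t)))
    (Ioi_mem_nhds (by linarith)) (.of_forall fun r => by fun_prop)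
    (integrableOn_besselK n hr) (by fun_prop) ?_
    (integrableOn_exp_mul_cosh_cosh n (by positivity)) ?_).2
  · refine .of_forall fun t s hs => ?_
    have h1 : 0 < Real.cosh t * Real.cosh (n * t) := mul_pos (Real.cosh_pos _) (Real.cosh_pos _)
    rw [norm_neg, Real.norm_of_nonneg (mul_nonneg (Real.exp_pos _).le h1.le)]
    refine mul_le_mul_of_nonneg_right (Real.exp_le_exp.2 (neg_le_neg ?_)) h1.le
    exact mul_le_mul_of_nonneg_right (le_of_lt hs) (Real.cosh_pos _).le
  · refine .of_forall fun t s _ => ?_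
    have h : HasDerivAt (fun s => -(s * Real.cosh t)) (-(1 * Real.cosh t)) s :=
      ((hasDerivAt_id s).mul_const _).neg
    refine (h.exp.mul_const _).congr_deriv ?_
    ring

/-- Integration by parts in the integral defining `K_n`. -/
lemma integral_exp_mul_sinh_sinh (n : ℕ) {r : ℝ} (hr : 0 < r) :
    ∫ t in Ioi (0 : ℝ), Real.exp (-(r * Real.cosh t)) * (Real.sinh t * Real.sinh (n * t)) =
      n / r * besselK n r := by
  have hderiv : ∀ t : ℝ, HasDerivAt (fun t => Real.exp (-(r * Real.cosh t)) * Real.sinh (n * t))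
      (-r * (Real.exp (-(r * Real.cosh t)) * (Real.sinh t * Real.sinh (n * t))) +
        n * (Real.exp (-(r * Real.cosh t)) * Real.cosh (n * t))) t := by
    intro t
    have h1 : HasDerivAt (fun t => -(r * Real.cosh t)) (-(r * Real.sinh t)) t :=
      ((Real.hasDerivAt_cosh t).const_mul r).neg
    have h2 : HasDerivAt (fun t : ℝ => Real.sinh (n * t)) (Real.cosh (n * t) * (n * 1)) t :=
      ((hasDerivAt_id t).const_mul (n : ℝ)).sinh
    refine (h1.exp.mul h2).congr_deriv ?_
    ring
  have hi1 := (integrableOn_exp_mul_sinh_sinh n hr).const_mul (-r)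
  have hi2 := (integrableOn_besselK n hr).const_mul (n : ℝ)
  have hlim : Tendsto (fun t => Real.exp (-(r * Real.cosh t)) * Real.sinh (n * t)) atTop (𝓝 0) := by
    refine squeeze_zero_norm' (a := fun t =>
      ((n + 1).factorial : ℝ) * (2 / r) ^ (n + 1) * Real.exp (-t)) ?_ ?_
    · filter_upwards [eventually_ge_atTop 0] with t ht
      refine le_trans ?_ (exp_neg_mul_cosh_mul_le n hr ht)
      rw [norm_mul, Real.norm_of_nonneg (Real.exp_pos _).le]
      gcongr
      exact abs_sinh_le_cosh _
    · simpa using Real.tendsto_exp_neg_atTop_nhds_zero.const_mul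
        (((n + 1).factorial : ℝ) * (2 / r) ^ (n + 1))
  have h := integral_Ioi_of_hasDerivAt_of_tendsto' (a := 0) (fun t _ => hderiv t)
    (hi1.add hi2) hlim
  rw [integral_add hi1 hi2, integral_const_mul, integral_const_mul] at h
  simp only [mul_zero, Real.sinh_zero, sub_zero] at h
  rw [besselK, div_mul_eq_mul_div, eq_div_iff hr.ne']
  linarith

/-- `K_n' = -K_{n+1} + (n/r) K_n`. -/
lemma hasDerivAt_besselK (n : ℕ) {r : ℝ} (hr : 0 < r) :
    HasDerivAt (besselK n) (-besselK (n + 1) r + n / r * besselK n r) r := by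
  refine (hasDerivAt_besselK_aux n hr).congr_deriv ?_
  rw [← integral_exp_mul_sinh_sinh n hr, besselK, ← sub_eq_neg_add, neg_eq_iff_eq_neg, neg_sub,
    ← integral_sub (integrableOn_besselK (n + 1) hr) (integrableOn_exp_mul_sinh_sinh n hr)]
  refine integral_congr_ae (.of_forall fun t => ?_)
  have h3 : Real.cosh (((n + 1 : ℕ) : ℝ) * t) =
      Real.cosh t * Real.cosh (n * t) + Real.sinh t * Real.sinh (n * t) := by
    push_cast
    rw [add_mul, one_mul, add_comm, Real.cosh_add]
  simp only [h3]
  ring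

/-- `K_{n+1}' = -K_n - ((n+1)/r) K_{n+1}`. -/
lemma hasDerivAt_besselK_succ (n : ℕ) {r : ℝ} (hr : 0 < r) :
    HasDerivAt (besselK (n + 1)) (-besselK n r - (n + 1) / r * besselK (n + 1) r) r := by
  refine (hasDerivAt_besselK_aux (n + 1) hr).congr_deriv ?_
  have h := integral_exp_mul_sinh_sinh (n + 1) hr
  push_cast at h
  rw [← h, besselK, ← neg_add', neg_inj,
    ← integral_add (integrableOn_besselK n hr)
      (by exact_mod_cast integrableOn_exp_mul_sinh_sinh (n + 1) hr)]
  refine integral_congr_ae (.of_forall fun t => ?_)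
  have h3 : Real.cosh ((n : ℝ) * t) =
      Real.cosh t * Real.cosh ((n + 1) * t) - Real.sinh t * Real.sinh ((n + 1) * t) := by
    rw [← Real.cosh_sub, ← Real.cosh_neg]; ring_nf
  simp only [h3]
  push_cast
  ring

/-- `K_{n+2} - K_n = (2(n+1)/r) K_{n+1}`. -/
lemma besselK_recurrence (n : ℕ) {r : ℝ} (hr : 0 < r) :
    besselK (n + 2) r = besselK n r + 2 * (n + 1) / r * besselK (n + 1) r := by
  have h := (hasDerivAt_besselK (n + 1) hr).unique (hasDerivAt_besselK_succ n hr)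
  push_cast at h
  have h' : n + 1 + 1 = n + 2 := rfl
  rw [h'] at h
  have : 2 * ((n : ℝ) + 1) / r = 2 * ((n + 1) / r) := by ring
  rw [this]
  linarith

lemma besselK_two_eq {r : ℝ} (hr : 0 < r) :
    besselK 2 r = besselK 0 r + 2 / r * besselK 1 r := by
  simpa using besselK_recurrence 0 hr

lemma hasDerivAt_besselK_zero {r : ℝ} (hr : 0 < r) :
    HasDerivAt (besselK 0) (-besselK 1 r) r := by
  simpa using hasDerivAt_besselK 0 hr

lemma hasDerivAt_besselK_one {r : ℝ} (hr : 0 < r) :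
    HasDerivAt (besselK 1) (-besselK 0 r - besselK 1 r / r) r := by
  refine (hasDerivAt_besselK_succ 0 hr).congr_deriv ?_
  simp; ring

lemma besselK_pos (n : ℕ) {r : ℝ} (hr : 0 < r) : 0 < besselK n r := by
  have hpos : ∀ t, 0 < Real.exp (-(r * Real.cosh t)) * Real.cosh (n * t) :=
    fun t => mul_pos (Real.exp_pos _) (Real.cosh_pos _)
  refine (setIntegral_pos_iff_support_of_nonneg_ae (.of_forall fun t => (hpos t).le)
    (integrableOn_besselK n hr)).2 ?_
  have : Function.support (fun t => Real.exp (-(r * Real.cosh t)) * Real.cosh (n * t)) = univ :=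
    eq_univ_of_forall fun t => (hpos t).ne'
  rw [this, univ_inter]
  simp

lemma besselK_zero_le_besselK_one {r : ℝ} (hr : 0 < r) : besselK 0 r ≤ besselK 1 r := by
  refine integral_mono (integrableOn_besselK 0 hr) (integrableOn_besselK 1 hr) fun t => ?_
  simp only [Nat.cast_zero, zero_mul, Real.cosh_zero, Nat.cast_one, one_mul]
  gcongr
  exact Real.one_le_cosh t

/-- The bounds `e^{-r} ≤ r K_1(r) ≤ (1 + r) e^{-r}`, from `∫ r sinh t e^{-r cosh t} dt = e^{-r}`
and `0 ≤ cosh t - sinh t = e^{-t}`. -/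
lemma mul_besselK_one_bounds {r : ℝ} (hr : 0 < r) :
    Real.exp (-r) ≤ r * besselK 1 r ∧ r * besselK 1 r ≤ (1 + r) * Real.exp (-r) := by
  have hderiv : ∀ t : ℝ, HasDerivAt (fun t => -Real.exp (-(r * Real.cosh t)))
      (r * Real.sinh t * Real.exp (-(r * Real.cosh t))) t := by
    intro t
    have h1 : HasDerivAt (fun t => -(r * Real.cosh t)) (-(r * Real.sinh t)) t :=
      ((Real.hasDerivAt_cosh t).const_mul r).neg
    refine h1.exp.neg.congr_deriv ?_
    ring
  have hlim : Tendsto (fun t => -Real.exp (-(r * Real.cosh t))) atTop (𝓝 0) := by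
    rw [← neg_zero]
    refine Tendsto.neg ?_
    refine squeeze_zero_norm' (a := fun t =>
      ((0 + 1).factorial : ℝ) * (2 / r) ^ (0 + 1) * Real.exp (-t)) ?_ ?_
    · filter_upwards [eventually_ge_atTop 0] with t ht
      simpa using exp_neg_mul_cosh_mul_le 0 hr ht
    · simpa only [mul_zero] using Real.tendsto_exp_neg_atTop_nhds_zero.const_mul
        (((0 + 1).factorial : ℝ) * (2 / r) ^ (0 + 1))
  have hK := (integrableOn_besselK 1 hr).const_mul r
  have hS : IntegrableOn (fun t => r * Real.sinh t * Real.exp (-(r * Real.cosh t))) (Ioi 0) := by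
    refine hK.mono' (by fun_prop) (.of_forall fun t => ?_)
    rw [norm_mul, norm_mul, Real.norm_of_nonneg hr.le, Real.norm_of_nonneg (Real.exp_pos _).le,
      mul_assoc, mul_comm (‖Real.sinh t‖)]
    gcongr
    simpa using abs_sinh_le_cosh t
  have hI := integral_Ioi_of_hasDerivAt_of_tendsto' (a := 0) (fun t _ => hderiv t) hS hlim
  simp only [Real.cosh_zero, mul_one, sub_neg_eq_add, zero_add] at hI
  have hrK : r * besselK 1 r = ∫ t in Ioi (0 : ℝ),
      r * (Real.exp (-(r * Real.cosh t)) * Real.cosh ((1 : ℕ) * t)) := by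
    rw [integral_const_mul]; rfl
  have hdiff : ∀ t, r * (Real.exp (-(r * Real.cosh t)) * Real.cosh ((1 : ℕ) * t)) -
      r * Real.sinh t * Real.exp (-(r * Real.cosh t)) =
      r * Real.exp (-(r * Real.cosh t)) * Real.exp (-t) := by
    intro t
    rw [← Real.cosh_sub_sinh t, Nat.cast_one, one_mul]; ring
  constructor
  · rw [← hI, hrK]
    refine integral_mono hS hK fun t => ?_
    have := hdiff t
    have h2 : 0 ≤ r * Real.exp (-(r * Real.cosh t)) * Real.exp (-t) := by positivity
    simp only
    linarith
  · have h1 : r * besselK 1 r - Real.exp (-r) ≤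
        ∫ t in Ioi (0 : ℝ), r * Real.exp (-r) * Real.exp (-t) := by
      have h2 : r * besselK 1 r - Real.exp (-r) = ∫ t in Ioi (0 : ℝ),
          (r * (Real.exp (-(r * Real.cosh t)) * Real.cosh ((1 : ℕ) * t)) -
            r * Real.sinh t * Real.exp (-(r * Real.cosh t))) := by
        rw [integral_sub hK hS, hI, hrK]
      rw [h2]
      refine integral_mono (hK.sub hS) ((integrableOn_exp_neg_Ioi 0).const_mul _) fun t => ?_
      simp only [hdiff]
      refine mul_le_mul_of_nonneg_right (mul_le_mul_of_nonneg_left (Real.exp_le_exp.2 ?_) hr.le)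
        (Real.exp_pos _).le
      nlinarith [Real.one_le_cosh t]
    rw [integral_const_mul, integral_exp_neg_Ioi_zero] at h1
    linarith

lemma tendsto_mul_besselK_one : Tendsto (fun r => r * besselK 1 r) (𝓝[>] 0) (𝓝 1) := by
  have h1 : Tendsto (fun r : ℝ => Real.exp (-r)) (𝓝[>] 0) (𝓝 1) := by
    have : Continuous fun r : ℝ => Real.exp (-r) := by fun_prop
    simpa using (this.tendsto 0).mono_left nhdsWithin_le_nhds
  have h2 : Tendsto (fun r : ℝ => (1 + r) * Real.exp (-r)) (𝓝[>] 0) (𝓝 1) := by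
    have : Continuous fun r : ℝ => (1 + r) * Real.exp (-r) := by fun_prop
    simpa using (this.tendsto 0).mono_left nhdsWithin_le_nhds
  refine tendsto_of_tendsto_of_tendsto_of_le_of_le' h1 h2 ?_ ?_
  · filter_upwards [self_mem_nhdsWithin] with r hr using (mul_besselK_one_bounds hr).1
  · filter_upwards [self_mem_nhdsWithin] with r hr using (mul_besselK_one_bounds hr).2

lemma tendsto_sq_mul_besselK_zero : Tendsto (fun r => r ^ 2 * besselK 0 r) (𝓝[>] 0) (𝓝 0) := by
  have h : Tendsto (fun r : ℝ => r * (r * besselK 1 r)) (𝓝[>] 0) (𝓝 0) := by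
    simpa using (tendsto_id.mono_left (nhdsWithin_le_nhds (s := Ioi (0 : ℝ)) (a := 0))).mul
      tendsto_mul_besselK_one
  refine tendsto_of_tendsto_of_tendsto_of_le_of_le' tendsto_const_nhds h ?_ ?_
  · filter_upwards [self_mem_nhdsWithin] with r hr
    have := besselK_pos 0 hr
    positivity
  · filter_upwards [self_mem_nhdsWithin] with r hr
    rw [← mul_assoc, ← sq]
    exact mul_le_mul_of_nonneg_left (besselK_zero_le_besselK_one hr) (sq_nonneg r)

/-! ### Wronskian and Turán-type identities -/

/-- A function with vanishing derivative on `(0, R)` equals its limit at `0`. -/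
lemma eq_const_of_hasDerivAt_zero {f : ℝ → ℝ} {R c : ℝ}
    (hf : ∀ r, 0 < r → r < R → HasDerivAt f 0 r) (hlim : Tendsto f (𝓝[>] 0) (𝓝 c))
    {r : ℝ} (hr : 0 < r) (hrR : r < R) : f r = c := by
  have hc : ∀ s ∈ Ioo 0 R, f s = f r := fun s hs =>
    isOpen_Ioo.is_const_of_deriv_eq_zero isPreconnected_Ioo
      (fun s hs => (hf s hs.1 hs.2).differentiableAt.differentiableWithinAt)
      (fun s hs => (hf s hs.1 hs.2).deriv) hs ⟨hr, hrR⟩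
  refine tendsto_nhds_unique (tendsto_const_nhds.congr' ?_) hlim
  filter_upwards [Ioo_mem_nhdsGT (hr.trans hrR)] with s hs using (hc s hs).symm

/-- The Wronskian identity `I_0 K_1 + I_1 K_0 = 1/r`. -/
lemma bessel_wronskian {r : ℝ} (hr : 0 < r) :
    r * (besselI 0 r * besselK 1 r + besselI 1 r * besselK 0 r) = 1 := by
  refine eq_const_of_hasDerivAt_zero (R := r + 1)
    (f := fun r => r * (besselI 0 r * besselK 1 r + besselI 1 r * besselK 0 r)) ?_ ?_ hr
    (lt_add_one r)
  · intro s hs _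
    refine ((hasDerivAt_id s).mul (((hasDerivAt_besselI_zero hs.ne').mul
      (hasDerivAt_besselK_one hs)).add ((hasDerivAt_besselI_one hs.ne').mul
      (hasDerivAt_besselK_zero hs)))).congr_deriv ?_
    simp only [id, Pi.add_apply, Pi.mul_apply]
    field_simp
    ring
  · have h0 : Tendsto (besselI 0) (𝓝[>] 0) (𝓝 1) := by
      simpa [besselI_zero_zero] using
        ((continuous_besselI 0).tendsto 0).mono_left (nhdsWithin_le_nhds (s := Ioi 0))
    have hS : Tendsto (fun r : ℝ => besselSeries 1 (r ^ 2 / 4) / 2) (𝓝[>] 0) (𝓝 (1 / 2)) := by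
      have : Continuous fun r : ℝ => besselSeries 1 (r ^ 2 / 4) / 2 := by
        have := continuous_besselSeries 1
        fun_prop
      simpa [besselSeries_one_zero] using
        (this.tendsto 0).mono_left (nhdsWithin_le_nhds (s := Ioi 0))
    have h := (h0.mul tendsto_mul_besselK_one).add (hS.mul tendsto_sq_mul_besselK_zero)
    simp only [mul_one, mul_zero, add_zero] at h
    refine h.congr fun s => ?_
    rw [besselI_eq 1 s]
    ring

/-- The Turán determinant `I_1² - I_0 I_2`. A primitive of `r I_1²` is `r²/2` times it. -/
def turanI (r : ℝ) : ℝ := besselI 1 r ^ 2 - besselI 0 r * besselI 2 r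

/-- The Turán determinant `K_0 K_2 - K_1²`. A primitive of `r K_1²` is `-r²/2` times it. -/
def turanK (r : ℝ) : ℝ := besselK 0 r * besselK 2 r - besselK 1 r ^ 2

/-- The mixed expression `I_1 K_1 + I_2 K_0`. A primitive of `r I_1 K_1` is `r²/2` times it. -/
def crossIK (r : ℝ) : ℝ := besselI 1 r * besselK 1 r + besselI 2 r * besselK 0 r

lemma hasDerivAt_sq_mul_turanI {r : ℝ} (hr : r ≠ 0) :
    HasDerivAt (fun r => r ^ 2 * turanI r) (2 * r * besselI 1 r ^ 2) r := by
  refine ((hasDerivAt_pow 2 r).mul (((hasDerivAt_besselI_one hr).pow 2).sub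
    ((hasDerivAt_besselI_zero hr).mul (hasDerivAt_besselI_two hr)))).congr_deriv ?_
  simp only [Pi.sub_apply, Pi.mul_apply, Pi.pow_apply, besselI_two_eq hr]
  push_cast
  field_simp
  ring

lemma hasDerivAt_sq_mul_crossIK {r : ℝ} (hr : 0 < r) :
    HasDerivAt (fun r => r ^ 2 * crossIK r) (2 * r * (besselI 1 r * besselK 1 r)) r := by
  refine ((hasDerivAt_pow 2 r).mul (((hasDerivAt_besselI_one hr.ne').mul
    (hasDerivAt_besselK_one hr)).add ((hasDerivAt_besselI_two hr.ne').mul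
    (hasDerivAt_besselK_zero hr)))).congr_deriv ?_
  simp only [Pi.add_apply, Pi.mul_apply, besselI_two_eq hr.ne']
  push_cast
  field_simp
  ring

lemma hasDerivAt_sq_mul_turanK {r : ℝ} (hr : 0 < r) :
    HasDerivAt (fun r => r ^ 2 * turanK r) (-(2 * r * besselK 1 r ^ 2)) r := by
  refine ((hasDerivAt_pow 2 r).mul (((hasDerivAt_besselK_zero hr).mul
    (hasDerivAt_besselK_succ 1 hr)).sub ((hasDerivAt_besselK_one hr).pow 2))).congr_deriv ?_
  simp only [Pi.sub_apply, Pi.mul_apply, Pi.pow_apply, one_add_one_eq_two, besselK_two_eq hr]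
  push_cast
  field_simp
  ring

lemma continuous_turanI : Continuous turanI := by
  have := continuous_besselI
  unfold turanI
  fun_prop

/-- `r² (I_1² - I_0 I_2)` vanishes at `0` and has derivative `2 r I_1² > 0`. -/
lemma turanI_pos {r : ℝ} (hr : 0 < r) : 0 < turanI r := by
  have hmono : StrictMonoOn (fun r => r ^ 2 * turanI r) (Ici 0) := by
    refine strictMonoOn_of_deriv_pos (convex_Ici 0) ?_ fun s hs => ?_
    · have := continuous_turanI
      fun_prop
    · rw [interior_Ici, mem_Ioi] at hs
      rw [(hasDerivAt_sq_mul_turanI hs.ne').deriv]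
      have := besselI_pos 1 hs
      positivity
  have h := hmono self_mem_Ici hr.le hr
  simp only [ne_eq, OfNat.ofNat_ne_zero, not_false_eq_true, zero_pow, zero_mul] at h
  exact pos_of_mul_pos_right h (sq_nonneg r)

lemma tendsto_sq_mul_crossIK : Tendsto (fun r => r ^ 2 * crossIK r) (𝓝[>] 0) (𝓝 0) := by
  have h1 : Tendsto (fun r => r * besselI 1 r) (𝓝[>] 0) (𝓝 0) := by
    have hc : Continuous fun r => r * besselI 1 r := continuous_id.mul (continuous_besselI 1)
    simpa using (hc.tendsto 0).mono_left (nhdsWithin_le_nhds (s := Ioi 0))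
  have h2 : Tendsto (besselI 2) (𝓝[>] 0) (𝓝 0) := by
    simpa [besselI_succ_zero 1] using
      ((continuous_besselI 2).tendsto 0).mono_left (nhdsWithin_le_nhds (s := Ioi 0))
  have h := (h1.mul tendsto_mul_besselK_one).add (h2.mul tendsto_sq_mul_besselK_zero)
  simp only [zero_mul, add_zero] at h
  refine h.congr fun s => ?_
  rw [crossIK]
  ring

lemma tendsto_sq_mul_turanI : Tendsto (fun r => r ^ 2 * turanI r) (𝓝[>] 0) (𝓝 0) := by
  have hc : Continuous fun r => r ^ 2 * turanI r := (continuous_pow 2).mul continuous_turanI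
  simpa using (hc.tendsto 0).mono_left (nhdsWithin_le_nhds (s := Ioi 0))

lemma tendsto_mul_besselK_one_atTop : Tendsto (fun r => r * besselK 1 r) atTop (𝓝 0) := by
  have h1 : Tendsto (fun r : ℝ => Real.exp (-r) + r * Real.exp (-r)) atTop (𝓝 0) := by
    simpa using Real.tendsto_exp_neg_atTop_nhds_zero.add
      (by simpa using Real.tendsto_pow_mul_exp_neg_atTop_nhds_zero 1)
  refine tendsto_of_tendsto_of_tendsto_of_le_of_le' tendsto_const_nhds h1 ?_ ?_
  · filter_upwards [eventually_gt_atTop 0] with r hr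
    exact mul_nonneg hr.le (besselK_pos 1 hr).le
  · filter_upwards [eventually_gt_atTop 0] with r hr
    refine (mul_besselK_one_bounds hr).2.trans (le_of_eq (by ring))

lemma tendsto_besselK_one_atTop : Tendsto (besselK 1) atTop (𝓝 0) := by
  refine tendsto_of_tendsto_of_tendsto_of_le_of_le' tendsto_const_nhds
    tendsto_mul_besselK_one_atTop ?_ ?_
  · filter_upwards [eventually_gt_atTop 0] with r hr using (besselK_pos 1 hr).le
  · filter_upwards [eventually_ge_atTop 1] with r hr
    exact le_mul_of_one_le_left (besselK_pos 1 (by linarith)).le hr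

lemma tendsto_mul_besselK_zero_atTop : Tendsto (fun r => r * besselK 0 r) atTop (𝓝 0) := by
  refine tendsto_of_tendsto_of_tendsto_of_le_of_le' tendsto_const_nhds
    tendsto_mul_besselK_one_atTop ?_ ?_
  · filter_upwards [eventually_gt_atTop 0] with r hr
    exact mul_nonneg hr.le (besselK_pos 0 hr).le
  · filter_upwards [eventually_gt_atTop 0] with r hr
    exact mul_le_mul_of_nonneg_left (besselK_zero_le_besselK_one hr) hr.le

lemma tendsto_sq_mul_turanK : Tendsto (fun r => r ^ 2 * turanK r) atTop (𝓝 0) := by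
  have h := (((tendsto_mul_besselK_zero_atTop).pow 2).add
    ((tendsto_mul_besselK_zero_atTop.mul tendsto_besselK_one_atTop).const_mul 2)).sub
    ((tendsto_mul_besselK_one_atTop).pow 2)
  norm_num at h
  refine h.congr' ?_
  filter_upwards [eventually_gt_atTop 0] with r hr
  rw [turanK, besselK_two_eq hr]
  field_simp

/-- The identity that turns the contribution of the exterior and of the interior of a ball into
the function `G`. -/
lemma turan_identity {r : ℝ} (hr : 0 < r) :
    r ^ 2 * (crossIK r ^ 2 + turanK r * turanI r) + 2 * crossIK r = 1 := by
  have h := bessel_wronskian hr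
  rw [crossIK, turanK, turanI, besselI_two_eq hr.ne', besselK_two_eq hr]
  field_simp
  linear_combination (r * (r * (besselI 0 r * besselK 1 r + besselI 1 r * besselK 0 r) + 1 -
    2 * (besselI 1 r * besselK 1 r + besselI 0 r * besselK 0 r)) +
    4 * besselI 1 r * besselK 0 r) * h

lemma G_eq (r : ℝ) : G r = (1 / (4 * π ^ 2)) * ((1 - 2 * crossIK r) / turanI r) := by
  rw [G, crossIK, turanI]
  ring

lemma G_pos {r : ℝ} (hr : 0 < r) : 0 < G r := by
  have h := bessel_wronskian hr
  have hK0 := besselK_pos 0 hr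
  have hK1 := besselK_pos 1 hr
  have hI2 := besselI_pos 2 hr
  have hI3 := besselI_pos 3 hr
  have hrec := besselI_recurrence 1 r
  norm_num at hrec
  have h2 := besselI_recurrence 0 r
  norm_num at h2
  have hT := turanI_pos hr
  -- the Wronskian and the recurrence for `I_n` write the numerator of `G` as a sum of positive
  -- terms
  have hnum : 1 - 2 * crossIK r =
      besselK 0 r * (r * besselI 3 r + 2 * besselI 2 r) + r * besselI 2 r * besselK 1 r := by
    rw [crossIK]
    linear_combination -h - besselK 0 r * hrec - besselK 1 r * h2
  rw [G_eq, hnum]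
  positivity

/-! ### The coefficients of `μ^x_ε` -/

lemma deriv_besselI_one {r : ℝ} (hr : r ≠ 0) :
    deriv (besselI 1) r = besselI 0 r - besselI 1 r / r := (hasDerivAt_besselI_one hr).deriv

lemma deriv_deriv_besselI_one {r : ℝ} (hr : r ≠ 0) :
    deriv (deriv (besselI 1)) r = besselI 1 r - besselI 2 r / r := by
  have h : deriv (besselI 1) =ᶠ[𝓝 r] fun r => besselI 0 r - besselI 1 r / r := by
    filter_upwards [isOpen_ne.mem_nhds hr] with s hs using deriv_besselI_one hs
  rw [h.deriv_eq]
  refine (((hasDerivAt_besselI_zero hr).sub ((hasDerivAt_besselI_one hr).div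
    (hasDerivAt_id r) hr)).congr_deriv ?_).deriv
  rw [besselI_two_eq hr]
  simp only [id]
  field_simp
  ring

lemma det_matB {r : ℝ} (hr : r ≠ 0) : (matB r).det = turanI r / r := by
  rw [matB, Matrix.det_fin_two_of, deriv_besselI_one hr, deriv_deriv_besselI_one hr, turanI,
    besselI_two_eq hr]
  field_simp
  ring

lemma vecMul_matB_inv {r : ℝ} (hr : 0 < r) :
    Matrix.vecMul ![1, 1] (matB r)⁻¹ =
      ![(r * besselI 1 r - 2 * besselI 2 r) / turanI r, -(r * besselI 2 r) / turanI r] := by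
  have hT := (turanI_pos hr).ne'
  have hr' := hr.ne'
  rw [Matrix.inv_def, det_matB hr', matB, Matrix.adjugate_fin_two_of, deriv_besselI_one hr',
    deriv_deriv_besselI_one hr', Ring.inverse_eq_inv', besselI_two_eq hr']
  ext i
  fin_cases i
  · simp [Matrix.vecMul, dotProduct, Fin.sum_univ_two]
    field_simp
    ring
  · simp [Matrix.vecMul, dotProduct, Fin.sum_univ_two]
    field_simp
    ring

/-! ### The radial solutions `I_1(r)/r` and `K_1(r)/r` of `(I - Δ) u = 0` -/

/-- The profile `I_1(r)/r` of the radial solution of `Δ u = u` that is regular at the origin,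
written so that its value at `r = 0` is the limit `1/2`. -/
def radI (r : ℝ) : ℝ := besselSeries 1 (r ^ 2 / 4) / 2

/-- The profile `K_1(r)/r` of the radial solution of `Δ u = u` that decays at infinity. -/
def radK (r : ℝ) : ℝ := besselK 1 r / r

lemma radI_eq {r : ℝ} (hr : r ≠ 0) : radI r = besselI 1 r / r := by
  rw [radI, besselI_eq]
  field_simp

lemma radI_zero : radI 0 = 1 / 2 := by simp [radI, besselSeries_one_zero]

lemma continuous_radI : Continuous radI := by
  have := continuous_besselSeries 1
  unfold radI
  fun_prop

lemma radI_pos (r : ℝ) : 0 < radI r := by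
  have := besselSeries_pos 1 (w := r ^ 2 / 4) (by positivity)
  unfold radI
  positivity

lemma radK_pos {r : ℝ} (hr : 0 < r) : 0 < radK r := div_pos (besselK_pos 1 hr) hr

lemma hasDerivAt_radI {r : ℝ} (hr : r ≠ 0) : HasDerivAt radI (besselI 2 r / r) r := by
  have h : radI =ᶠ[𝓝 r] fun r => besselI 1 r / r := by
    filter_upwards [isOpen_ne.mem_nhds hr] with s hs using radI_eq hs
  refine (((hasDerivAt_besselI_one hr).div (hasDerivAt_id r) hr).congr_deriv
    ?_).congr_of_eventuallyEq h
  rw [besselI_two_eq hr]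
  simp only [id]
  field_simp
  ring

lemma hasDerivAt_radK {r : ℝ} (hr : 0 < r) : HasDerivAt radK (-(besselK 2 r / r)) r := by
  refine ((hasDerivAt_besselK_one hr).div (hasDerivAt_id r) hr.ne').congr_deriv ?_
  rw [besselK_two_eq hr]
  simp only [id]
  field_simp
  ring

/-- The radial form `(r³ u')' = r³ u` of `Δ u = u` for `u = I_1(r)/r`. -/
lemma hasDerivAt_cube_mul_deriv_radI {r : ℝ} (hr : r ≠ 0) :
    HasDerivAt (fun r => r ^ 2 * besselI 2 r) (r ^ 3 * radI r) r := by
  refine ((hasDerivAt_pow 2 r).mul (hasDerivAt_besselI_two hr)).congr_deriv ?_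
  rw [radI_eq hr]
  push_cast
  field_simp
  ring

/-- The radial form `(r³ u')' = r³ u` of `Δ u = u` for `u = K_1(r)/r`. -/
lemma hasDerivAt_cube_mul_deriv_radK {r : ℝ} (hr : 0 < r) :
    HasDerivAt (fun r => -(r ^ 2 * besselK 2 r)) (r ^ 3 * radK r) r := by
  refine ((hasDerivAt_pow 2 r).mul (hasDerivAt_besselK_succ 1 hr)).neg.congr_deriv ?_
  rw [radK]
  norm_num
  field_simp
  ring

/-! ### Spherical averages and polar coordinates -/

lemma toSphere_real_univ : (volume : Measure E4).toSphere.real univ = 2 * π ^ 2 := by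
  rw [Measure.toSphere_real_apply_univ, measureReal_def, EuclideanSpace.volume_ball]
  have hG : Real.Gamma (4 / 2 + 1) = 2 := by
    rw [show (4 / 2 + 1 : ℝ) = ((2 : ℕ) : ℝ) + 1 by norm_num, Real.Gamma_nat_eq_factorial]
    norm_num
  have hs : √π ^ 4 = π ^ 2 := by
    rw [show (4 : ℕ) = 2 * 2 from rfl, pow_mul, Real.sq_sqrt Real.pi_pos.le]
  simp [hG, hs, ENNReal.toReal_ofReal (by positivity : 0 ≤ π ^ 2 / 2)]
  ring

lemma sphericalAverage_congr {x : E4} {r : ℝ} {f g : E4 → ℝ} (hr : 0 ≤ r)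
    (h : ∀ z, ‖z - x‖ = r → f z = g z) : sphericalAverage x r f = sphericalAverage x r g := by
  unfold sphericalAverage
  congr 1
  refine integral_congr_ae (.of_forall fun ω => h _ ?_)
  simp [norm_smul, abs_of_nonneg hr]

lemma sphericalAverage_const (x : E4) (r c : ℝ) : sphericalAverage x r (fun _ => c) = c := by
  simp only [sphericalAverage, integral_const, toSphere_real_univ, smul_eq_mul]
  field_simp

lemma sphericalAverage_const_mul (x : E4) (r c : ℝ) (f : E4 → ℝ) :
    sphericalAverage x r (fun z => c * f z) = c * sphericalAverage x r f := by
  simp only [sphericalAverage, integral_const_mul]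
  ring

lemma sphericalAverage_sub (x : E4) (r : ℝ) (f g : 𝓢(E4, ℝ)) :
    sphericalAverage x r (fun z => f z - g z) =
      sphericalAverage x r f - sphericalAverage x r g := by
  simp only [sphericalAverage]
  rw [integral_sub (integrable_sphere x r f) (integrable_sphere x r g), mul_sub]

/-- A radial factor comes out of the spherical average. -/
lemma sphericalAverage_mul_radial {x : E4} {r : ℝ} (hr : 0 ≤ r) (f : E4 → ℝ) (w : ℝ → ℝ) :
    sphericalAverage x r (fun z => w ‖z - x‖ * f z) = w r * sphericalAverage x r f := by
  rw [← sphericalAverage_const_mul]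
  exact sphericalAverage_congr hr fun z hz => by rw [hz]

lemma sphericalAverage_zero (x : E4) (f : E4 → ℝ) : sphericalAverage x 0 f = f x := by
  have := sphericalAverage_const x 0 (f x)
  simpa [sphericalAverage] using this

/-- Integration in polar coordinates about `x`. -/
lemma integral_eq_integral_sphericalAverage (x : E4) {F : E4 → ℝ} (hF : Integrable F) :
    ∫ z, F z = 2 * π ^ 2 * ∫ r in Ioi (0 : ℝ), r ^ 3 * sphericalAverage x r F := by
  have hdim : Module.finrank ℝ E4 - 1 = 3 := by simp
  have hmp := (volume : Measure E4).measurePreserving_homeomorphUnitSphereProd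
  rw [hdim] at hmp
  have hme := (homeomorphUnitSphereProd E4).measurableEmbedding
  set g : Metric.sphere (0 : E4) 1 × Ioi (0 : ℝ) → ℝ := fun p => F (x + (p.2 : ℝ) • (p.1 : E4))
    with hg
  have hgF : ∀ z : ({0}ᶜ : Set E4), g (homeomorphUnitSphereProd E4 z) = F (x + z) := by
    intro z
    have h : ((homeomorphUnitSphereProd E4).symm (homeomorphUnitSphereProd E4 z) : E4) = z := by
      rw [Homeomorph.symm_apply_apply]
    rw [homeomorphUnitSphereProd_symm_apply_coe] at h
    simp only [hg, h]
  have hFx : Integrable fun z => F (x + z) := hF.comp_add_left x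
  have hgi : Integrable g ((volume : Measure E4).toSphere.prod (Measure.volumeIoiPow 3)) := by
    rw [← hmp.integrable_comp_emb hme]
    have : g ∘ homeomorphUnitSphereProd E4 = (fun z : E4 => F (x + z)) ∘ (↑) := funext hgF
    rw [this]
    refine (integrableOn_iff_comap_subtypeVal (measurableSet_singleton _).compl).1
      hFx.integrableOn
  calc ∫ z, F z = ∫ z, F (x + z) := (integral_add_left_eq_self F x).symm
    _ = ∫ z : ({0}ᶜ : Set E4), F (x + z) ∂((volume : Measure E4).comap (↑)) := by
        rw [integral_subtype_comap (measurableSet_singleton _).compl fun z => F (x + z),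
          restrict_compl_singleton]
    _ = ∫ p, g p ∂((volume : Measure E4).toSphere.prod (Measure.volumeIoiPow 3)) := by
        rw [← hmp.integral_comp hme]
        exact integral_congr_ae (.of_forall fun z => (hgF z).symm)
    _ = ∫ r : Ioi (0 : ℝ), (∫ ω, g (ω, r) ∂(volume : Measure E4).toSphere)
          ∂(Measure.volumeIoiPow 3) := integral_prod_symm _ hgi
    _ = ∫ r : Ioi (0 : ℝ), (fun s : ℝ => 2 * π ^ 2 * sphericalAverage x s F) r
          ∂(Measure.volumeIoiPow 3) := by
        refine integral_congr_ae (.of_forall fun r => ?_)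
        simp only [sphericalAverage, hg]
        field_simp
    _ = _ := by
        rw [← integral_const_mul]
        simp only [Measure.volumeIoiPow, ENNReal.ofReal]
        rw [integral_withDensity_eq_integral_smul, integral_subtype_comap measurableSet_Ioi
          fun a : ℝ => Real.toNNReal (a ^ 3) • (2 * π ^ 2 * sphericalAverage x a F)]
        · refine setIntegral_congr_fun measurableSet_Ioi fun r hr => ?_
          have hr : 0 < r := hr
          rw [NNReal.smul_def, Real.coe_toNNReal _ (by positivity), smul_eq_mul]
          ring
        · exact (measurable_subtype_coe.pow_const _).real_toNNReal

lemma integrable_radial_iff (x : E4) (w : ℝ → ℝ) :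
    Integrable (fun z : E4 => w ‖z - x‖) ↔ IntegrableOn (fun r => r ^ 3 * w r) (Ioi 0) := by
  have h := integrable_fun_norm_addHaar (volume : Measure E4) (f := w)
  simp only [finrank_euclideanSpace, Fintype.card_fin, Nat.add_one_sub_one, smul_eq_mul] at h
  rw [← h]
  refine ⟨fun h => ?_, fun h => h.comp_sub_right x⟩
  simpa using h.comp_add_right x

lemma integral_radial (x : E4) {w : ℝ → ℝ} (hw : IntegrableOn (fun r => r ^ 3 * w r) (Ioi 0)) :
    ∫ z : E4, w ‖z - x‖ = 2 * π ^ 2 * ∫ r in Ioi (0 : ℝ), r ^ 3 * w r := by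
  rw [integral_eq_integral_sphericalAverage x ((integrable_radial_iff x w).2 hw)]
  congr 1
  refine setIntegral_congr_fun measurableSet_Ioi fun r hr => ?_
  have := sphericalAverage_mul_radial (x := x) (le_of_lt hr) (fun _ => 1) w
  simp only [mul_one, sphericalAverage_const] at this
  simp only [this]

lemma continuous_sphericalAverage (x : E4) (f : 𝓢(E4, ℝ)) :
    Continuous fun r => sphericalAverage x r f :=
  continuous_iff_continuousAt.2 fun r => (hasDerivAt_sphericalAverage x r f).continuousAt

lemma abs_sphericalAverage_le {x : E4} {r C : ℝ} {f : E4 → ℝ} (hr : 0 ≤ r)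
    (h : ∀ z, ‖z - x‖ = r → |f z| ≤ C) : |sphericalAverage x r f| ≤ C := by
  rw [sphericalAverage, abs_mul, abs_of_pos (by positivity : 0 < 1 / (2 * π ^ 2))]
  have h1 := norm_integral_le_of_norm_le_const (μ := (volume : Measure E4).toSphere) (C := C)
    (f := fun ω : Metric.sphere (0 : E4) 1 => f (x + r • (ω : E4)))
    (.of_forall fun ω => h _ (by simp [norm_smul, abs_of_nonneg hr]))
  rw [toSphere_real_univ, Real.norm_eq_abs] at h1
  rw [div_mul_eq_mul_div, one_mul, div_le_iff₀ (by positivity)]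
  exact h1

/-- The derivative of `r ↦ ⟨f, σ^x_r⟩`. -/
def sphericalDeriv (x : E4) (r : ℝ) (f : 𝓢(E4, ℝ)) : ℝ :=
  (1 / (2 * π ^ 2)) * ∫ ω : Metric.sphere (0 : E4) 1,
    fderiv ℝ f (x + r • (ω : E4)) (ω : E4) ∂(volume : Measure E4).toSphere

lemma norm_fderiv_sphere_le (x : E4) (r : ℝ) (f : 𝓢(E4, ℝ)) (ω : Metric.sphere (0 : E4) 1) :
    ‖fderiv ℝ f (x + r • (ω : E4)) (ω : E4)‖ ≤ SchwartzMap.seminorm ℝ 0 1 f := by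
  refine ((fderiv ℝ f (x + r • (ω : E4))).le_opNorm _).trans ?_
  have : ‖(ω : E4)‖ = 1 := by simp
  rw [this, mul_one]
  exact norm_fderiv_le_seminorm f _

lemma continuous_sphericalDeriv (x : E4) (f : 𝓢(E4, ℝ)) :
    Continuous fun r => sphericalDeriv x r f := by
  have hc : Continuous (fderiv ℝ f) := (f.smooth 1).continuous_fderiv (by norm_num)
  refine continuous_const.mul (MeasureTheory.continuous_of_dominated
    (bound := fun _ => SchwartzMap.seminorm ℝ 0 1 f) (fun r => ?_)
    (fun r => .of_forall fun ω => norm_fderiv_sphere_le x r f ω) (integrable_const _)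
    (.of_forall fun ω => ?_))
  · refine Continuous.aestronglyMeasurable ?_
    exact (hc.comp (by fun_prop)).clm_apply continuous_subtype_val
  · exact (hc.comp (by fun_prop)).clm_apply continuous_const

lemma abs_sphericalDeriv_le (x : E4) (r : ℝ) (f : 𝓢(E4, ℝ)) :
    |sphericalDeriv x r f| ≤ SchwartzMap.seminorm ℝ 0 1 f := by
  rw [sphericalDeriv, abs_mul, abs_of_pos (by positivity : 0 < 1 / (2 * π ^ 2))]
  have h1 := norm_integral_le_of_norm_le_const (μ := (volume : Measure E4).toSphere)
    (.of_forall fun ω => norm_fderiv_sphere_le x r f ω)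
  rw [toSphere_real_univ, Real.norm_eq_abs] at h1
  rw [div_mul_eq_mul_div, one_mul, div_le_iff₀ (by positivity)]
  exact h1

/-! ### The Laplacian of a radial function -/

lemma hasFDerivAt_radial {p : ℝ → ℝ} {p' : ℝ} {x z : E4} (h : HasDerivAt p p' (‖z - x‖ ^ 2)) :
    HasFDerivAt (fun z => p (‖z - x‖ ^ 2)) ((2 * p') • innerSL ℝ (z - x)) z := by
  have h1 : HasFDerivAt (fun z : E4 => ‖z - x‖ ^ 2) ((2 : ℝ) • innerSL ℝ (z - x)) z := by
    have h2 := ((hasFDerivAt_id z).sub_const x).norm_sq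
    refine h2.congr_fderiv ?_
    ext v
    simp [two_smul]
  refine (h.comp_hasFDerivAt z h1).congr_fderiv ?_
  rw [smul_smul, mul_comm]

/-- In dimension four, `Δ p(|z|²) = 4 |z|² p''(|z|²) + 8 p'(|z|²)`. -/
lemma laplacian_radial {p p1 : ℝ → ℝ} {p2 : ℝ} {x z : E4}
    (h1 : ∀ᶠ q in 𝓝 (‖z - x‖ ^ 2), HasDerivAt p (p1 q) q)
    (h2 : HasDerivAt p1 p2 (‖z - x‖ ^ 2)) :
    Δ (fun z : E4 => p (‖z - x‖ ^ 2)) z = 4 * ‖z - x‖ ^ 2 * p2 + 8 * p1 (‖z - x‖ ^ 2) := by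
  have hcont : Continuous fun z : E4 => ‖z - x‖ ^ 2 := by fun_prop
  have hev : fderiv ℝ (fun z : E4 => p (‖z - x‖ ^ 2)) =ᶠ[𝓝 z]
      fun z => (2 * p1 (‖z - x‖ ^ 2)) • innerSL ℝ (z - x) := by
    filter_upwards [(hcont.tendsto z).eventually h1] with y hy
    exact (hasFDerivAt_radial hy).fderiv
  have hA : HasFDerivAt (fun z : E4 => 2 * p1 (‖z - x‖ ^ 2))
      ((2 : ℝ) • ((2 * p2) • innerSL ℝ (z - x))) z := (hasFDerivAt_radial h2).const_mul 2
  have hB : HasFDerivAt (fun z : E4 => innerSL ℝ (z - x)) (innerSL ℝ (E := E4)) z :=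
    (innerSL ℝ (E := E4)).hasFDerivAt.comp z ((hasFDerivAt_id z).sub_const x)
  have hsecond : ∀ v : E4, fderiv ℝ (fderiv ℝ (fun z : E4 => p (‖z - x‖ ^ 2))) z v v =
      4 * p2 * inner ℝ (z - x) v ^ 2 + 2 * p1 (‖z - x‖ ^ 2) * ‖v‖ ^ 2 := by
    intro v
    have hAB : HasFDerivAt (fun z : E4 => (2 * p1 (‖z - x‖ ^ 2)) • innerSL ℝ (z - x)) _ z :=
      hA.smul hB
    rw [hev.fderiv_eq, hAB.fderiv]
    have hv : ((innerSL ℝ (E := E4) : E4 →L[ℝ] E4 →L[ℝ] ℝ) v) v = ‖v‖ ^ 2 :=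
      real_inner_self_eq_norm_sq v
    simp only [add_apply, smul_apply, ContinuousLinearMap.smulRight_apply,
      innerSL_apply_apply, smul_eq_mul, hv]
    ring
  rw [InnerProductSpace.laplacian_eq_iteratedFDeriv_stdOrthonormalBasis]
  simp only [iteratedFDeriv_two_apply, Matrix.cons_val_zero, Matrix.cons_val_one, hsecond,
    OrthonormalBasis.norm_eq_one]
  rw [Finset.sum_add_distrib, ← Finset.mul_sum, OrthonormalBasis.sum_sq_inner_left]
  simp
  ring

section

open scoped ContDiff

/-! ### The Darboux equation for spherical averages -/

lemma hasDerivAt_sphericalAverage' (x : E4) (r : ℝ) (f : 𝓢(E4, ℝ)) :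
    HasDerivAt (fun r => sphericalAverage x r f) (sphericalDeriv x r f) r :=
  hasDerivAt_sphericalAverage x r f

/-- `∫₀^r s³ ⟨Δf, σ^x_s⟩ ds`, which is the integral of `Δf` over the ball of radius `r`
divided by `2π²`. -/
def laplacianFlux (x : E4) (r : ℝ) (f : 𝓢(E4, ℝ)) : ℝ :=
  ∫ s in (0 : ℝ)..r, s ^ 3 * sphericalAverage x s (Δ f : 𝓢(E4, ℝ))

lemma hasDerivAt_laplacianFlux (x : E4) (r : ℝ) (f : 𝓢(E4, ℝ)) :
    HasDerivAt (fun r => laplacianFlux x r f) (r ^ 3 * sphericalAverage x r (Δ f : 𝓢(E4, ℝ))) r :=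
  ((continuous_pow 3).mul (continuous_sphericalAverage x _)).integral_hasStrictDerivAt 0 r
    |>.hasDerivAt

lemma continuous_laplacianFlux (x : E4) (f : 𝓢(E4, ℝ)) :
    Continuous fun r => laplacianFlux x r f :=
  continuous_iff_continuousAt.2 fun r => (hasDerivAt_laplacianFlux x r f).continuousAt

lemma integral_Ioi_eq_intervalIntegral {h : ℝ → ℝ} {ρ : ℝ} (hρ : 0 ≤ ρ)
    (hh : ∀ r, ρ < r → h r = 0) :
    ∫ r in Ioi (0 : ℝ), h r = ∫ r in (0 : ℝ)..ρ, h r := by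
  rw [intervalIntegral.integral_of_le hρ]
  refine setIntegral_eq_of_subset_of_forall_sdiff_eq_zero measurableSet_Ioi Ioc_subset_Ioi_self ?_
  rintro r ⟨hr0, hr⟩
  exact hh r (by simpa [mem_Ioi.1 hr0] using hr)

/-- The Darboux equation tested against a smooth function `θ(r²)`: the radial function
`p(|z - x|²)` with `p' = θ` is paired with `Δ f`, and the Laplacian is moved to it. -/
lemma integral_darboux_test (x : E4) (f : 𝓢(E4, ℝ)) {θ : ℝ → ℝ} (hθ : ContDiff ℝ ∞ θ)
    {ρ : ℝ} (hρ : 0 < ρ) (hsupp : ∀ q, ρ ^ 2 ≤ q → θ q = 0) :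
    ∫ r in (0 : ℝ)..ρ,
      2 * r * θ (r ^ 2) * (r ^ 3 * sphericalDeriv x r f - laplacianFlux x r f) = 0 := by
  have hθc : Continuous θ := hθ.continuous
  have hθ' : ∀ q, HasDerivAt θ (deriv θ q) q := fun q =>
    (hθ.differentiable (by simp)).differentiableAt.hasDerivAt
  have hθ'c : Continuous (deriv θ) := hθ.continuous_deriv (by simp)
  -- the primitive `p` of `θ` vanishes beyond `ρ²`, so that `ψ = p(|z - x|²)` has compact support
  obtain ⟨p, hp_def⟩ : ∃ p : ℝ → ℝ, p = fun q => ∫ t in (ρ ^ 2)..q, θ t := ⟨_, rfl⟩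
  have hp : ∀ q, HasDerivAt p (θ q) q := fun q => by
    rw [hp_def]
    exact (hθc.integral_hasStrictDerivAt (ρ ^ 2) q).hasDerivAt
  have hpc : Continuous p := continuous_iff_continuousAt.2 fun q => (hp q).continuousAt
  have hp0 : ∀ q, ρ ^ 2 ≤ q → p q = 0 := by
    intro q hq
    rw [hp_def]
    refine (intervalIntegral.integral_congr (g := fun _ => 0) fun t ht => ?_).trans (by simp)
    rw [uIcc_of_le hq] at ht
    exact hsupp t ht.1
  have hps : ContDiff ℝ ∞ p := by
    refine contDiff_infty_iff_deriv.2 ⟨fun q => (hp q).differentiableAt, ?_⟩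
    rwa [show deriv p = θ from funext fun q => (hp q).deriv]
  have hψc : HasCompactSupport fun z : E4 => p (‖z - x‖ ^ 2) := by
    refine HasCompactSupport.of_support_subset_isCompact (isCompact_closedBall x ρ) fun z hz => ?_
    by_contra hzx
    refine hz (hp0 _ ?_)
    rw [Metric.mem_closedBall, dist_eq_norm, not_le] at hzx
    exact pow_le_pow_left₀ hρ.le hzx.le 2
  have hψs : ContDiff ℝ ∞ fun z : E4 => p (‖z - x‖ ^ 2) :=
    hps.comp ((contDiff_id.sub contDiff_const).norm_sq ℝ)
  obtain ⟨ψ, hψ⟩ : ∃ ψ : 𝓢(E4, ℝ), ∀ z, ψ z = p (‖z - x‖ ^ 2) :=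
    ⟨hψc.toSchwartzMap hψs, fun z => rfl⟩
  have hψΔ : ∀ z, (Δ ψ : 𝓢(E4, ℝ)) z =
      4 * ‖z - x‖ ^ 2 * deriv θ (‖z - x‖ ^ 2) + 8 * θ (‖z - x‖ ^ 2) := by
    intro z
    rw [SchwartzMap.laplacian_apply, show (ψ : E4 → ℝ) = fun z => p (‖z - x‖ ^ 2) from funext hψ]
    exact laplacian_radial (.of_forall hp) (hθ' _)
  have hparts := SchwartzMap.integral_mul_laplacian_right_eq_left (μ := volume) f ψ
  rw [integral_eq_integral_sphericalAverage x (integrable_mul_schwartz f (Δ ψ)),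
    integral_eq_integral_sphericalAverage x (integrable_mul_schwartz (Δ f) ψ),
    mul_right_inj' (by positivity)] at hparts
  have hleft : ∫ r in Ioi (0 : ℝ), r ^ 3 * sphericalAverage x r (fun z => f z * (Δ ψ) z) =
      ∫ r in (0 : ℝ)..ρ, r ^ 3 * ((4 * r ^ 2 * deriv θ (r ^ 2) + 8 * θ (r ^ 2)) *
        sphericalAverage x r f) := by
    rw [← integral_Ioi_eq_intervalIntegral hρ.le]
    · refine setIntegral_congr_fun measurableSet_Ioi fun r hr => ?_
      rw [← sphericalAverage_mul_radial (le_of_lt hr) (f : E4 → ℝ)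
        (fun r => 4 * r ^ 2 * deriv θ (r ^ 2) + 8 * θ (r ^ 2))]
      congr 2
      ext z
      rw [hψΔ, mul_comm]
    · intro r hr
      have h1 : ρ ^ 2 < r ^ 2 := pow_lt_pow_left₀ hr hρ.le two_ne_zero
      have h2 : deriv θ (r ^ 2) = 0 := by
        have : θ =ᶠ[𝓝 (r ^ 2)] fun _ => 0 := by
          filter_upwards [lt_mem_nhds h1] with q hq using hsupp q hq.le
        rw [this.deriv_eq, deriv_const]
      rw [h2, hsupp _ h1.le]
      ring
  have hright : ∫ r in Ioi (0 : ℝ), r ^ 3 * sphericalAverage x r (fun z => (Δ f) z * ψ z) =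
      ∫ r in (0 : ℝ)..ρ, r ^ 3 * (p (r ^ 2) * sphericalAverage x r (Δ f : 𝓢(E4, ℝ))) := by
    rw [← integral_Ioi_eq_intervalIntegral hρ.le]
    · refine setIntegral_congr_fun measurableSet_Ioi fun r hr => ?_
      rw [← sphericalAverage_mul_radial (le_of_lt hr) ((Δ f : 𝓢(E4, ℝ)) : E4 → ℝ)
        (fun r => p (r ^ 2))]
      congr 2
      ext z
      rw [hψ, mul_comm]
    · intro r hr
      rw [hp0 _ (pow_le_pow_left₀ hρ.le hr.le 2)]
      ring
  rw [hleft, hright] at hparts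
  have hA := continuous_sphericalAverage x f
  have hB := continuous_sphericalAverage x (Δ f : 𝓢(E4, ℝ))
  have hA' := continuous_sphericalDeriv x f
  have hC := continuous_laplacianFlux x f
  -- the integrand of the claim plus the difference of the integrands in `hparts` is a derivative
  have hderiv : ∀ r, HasDerivAt (fun r => 2 * r ^ 4 * θ (r ^ 2) * sphericalAverage x r f -
      p (r ^ 2) * laplacianFlux x r f)
      (2 * r * θ (r ^ 2) * (r ^ 3 * sphericalDeriv x r f - laplacianFlux x r f) +
        (r ^ 3 * ((4 * r ^ 2 * deriv θ (r ^ 2) + 8 * θ (r ^ 2)) * sphericalAverage x r f) -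
        r ^ 3 * (p (r ^ 2) * sphericalAverage x r (Δ f : 𝓢(E4, ℝ))))) r := by
    intro r
    have h2 : HasDerivAt (fun r : ℝ => r ^ 2) (2 * r) r := by simpa using hasDerivAt_pow 2 r
    have h4 : HasDerivAt (fun r : ℝ => 2 * r ^ 4) (2 * (4 * r ^ 3)) r := by
      simpa using (hasDerivAt_pow 4 r).const_mul 2
    have hθr : HasDerivAt (fun r : ℝ => θ (r ^ 2)) (deriv θ (r ^ 2) * (2 * r)) r :=
      (hθ' _).comp r h2
    have hpr : HasDerivAt (fun r : ℝ => p (r ^ 2)) (θ (r ^ 2) * (2 * r)) r := (hp _).comp r h2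
    refine (((h4.mul hθr).mul (hasDerivAt_sphericalAverage' x r f)).sub
      (hpr.mul (hasDerivAt_laplacianFlux x r f))).congr_deriv ?_
    simp only [Pi.mul_apply]
    ring
  have hFTC := intervalIntegral.integral_eq_sub_of_hasDerivAt (a := 0) (b := ρ)
    (fun r _ => hderiv r) (Continuous.intervalIntegrable (by fun_prop) _ _)
  rw [intervalIntegral.integral_add (Continuous.intervalIntegrable (by fun_prop) _ _)
    (Continuous.intervalIntegrable (by fun_prop) _ _),
    intervalIntegral.integral_sub (Continuous.intervalIntegrable (by fun_prop) _ _)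
    (Continuous.intervalIntegrable (by fun_prop) _ _), hparts, hsupp _ le_rfl, hp0 _ le_rfl] at hFTC
  simpa [laplacianFlux] using hFTC

/-- The Darboux equation in integrated form: the flux of `∇ f` through a sphere is the integral of
`Δ f` over the ball. -/
lemma cube_mul_sphericalDeriv (x : E4) (f : 𝓢(E4, ℝ)) {r : ℝ} (hr : 0 < r) :
    r ^ 3 * sphericalDeriv x r f = laplacianFlux x r f := by
  set E : ℝ → ℝ := fun r => r ^ 3 * sphericalDeriv x r f - laplacianFlux x r f with hE
  have hEc : Continuous E :=
    ((continuous_pow 3).mul (continuous_sphericalDeriv x f)).sub (continuous_laplacianFlux x f)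
  -- the test functions are smooth in `q = r²`, so the variable `q` is used throughout
  have hEs : Continuous fun q => E (√q) := hEc.comp Real.continuous_sqrt
  have hae := isOpen_Ioi.ae_eq_zero_of_integral_contDiff_smul_eq_zero (μ := volume)
    (U := Ioi (0 : ℝ)) (f := fun q => E (√q)) (hEs.locallyIntegrable.locallyIntegrableOn _)
    fun θ hθ hθc hθU => by
      have hneg : ∀ q, q ≤ 0 → θ q = 0 := fun q hq =>
        image_eq_zero_of_notMem_tsupport fun h => (not_lt.2 hq) (hθU h)
      obtain ⟨R, hR⟩ := hθc.isCompact.bddAbove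
      set ρ := √(max R 0 + 1)
      have hρ0 : 0 < ρ := by positivity
      have hsupp : ∀ q, ρ ^ 2 ≤ q → θ q = 0 := by
        intro q hq
        rw [Real.sq_sqrt (by positivity)] at hq
        refine image_eq_zero_of_notMem_tsupport fun h => ?_
        linarith [hR h, le_max_left R 0]
      have h1 := integral_darboux_test x f hθ hρ0 hsupp
      rw [← integral_Ioi_eq_intervalIntegral hρ0.le fun r hr => by
        rw [hsupp _ (pow_le_pow_left₀ hρ0.le hr.le 2)]; ring] at h1
      have h2 := integral_comp_rpow_Ioi_of_pos (g := fun q => θ q • E (√q)) (p := 2) two_pos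
      rw [← setIntegral_eq_integral_of_forall_compl_eq_zero (s := Ioi 0) fun q hq => by
        rw [hneg q (not_lt.1 hq), zero_smul], ← h2]
      refine Eq.trans ?_ h1
      refine setIntegral_congr_fun measurableSet_Ioi fun s hs => ?_
      have hs : 0 < s := hs
      have h3 : s ^ (2 : ℝ) = s ^ 2 := Real.rpow_two s
      have h4 : s ^ ((2 : ℝ) - 1) = s := by norm_num
      simp only [h3, h4, Real.sqrt_sq hs.le, smul_eq_mul, hE]
      ring
  have h0 : EqOn (fun q => E (√q)) 0 (Ioi 0) :=
    Measure.eqOn_open_of_ae_eq (μ := volume) ((ae_restrict_iff' measurableSet_Ioi).2 hae) isOpen_Ioi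
      hEs.continuousOn continuousOn_const
  have h := h0 (by positivity : (0 : ℝ) < r ^ 2)
  simp only [Real.sqrt_sq hr.le, Pi.zero_apply, hE] at h
  exact sub_eq_zero.1 h

/-- The Darboux equation `(r³ A')' = r³ ⟨Δf, σ^x_r⟩` for the spherical average `A`. -/
lemma hasDerivAt_cube_mul_sphericalDeriv (x : E4) (f : 𝓢(E4, ℝ)) {r : ℝ} (hr : 0 < r) :
    HasDerivAt (fun r => r ^ 3 * sphericalDeriv x r f)
      (r ^ 3 * sphericalAverage x r (Δ f : 𝓢(E4, ℝ))) r := by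
  refine (hasDerivAt_laplacianFlux x r f).congr_of_eventuallyEq ?_
  filter_upwards [lt_mem_nhds hr] with s hs using cube_mul_sphericalDeriv x f hs

/-! ### The mean value property for `Δ u = u` -/

/-- If `Δ f = f` in a ball, the spherical averages are `2 I_1(r)/r · f(x)`: the Wronskian of
the spherical average and `I_1(r)/r` vanishes. -/
lemma sphericalAverage_eq_of_laplacian_eq {x : E4} {f : 𝓢(E4, ℝ)} {R : ℝ}
    (hf : ∀ z, ‖z - x‖ < R → (Δ f : 𝓢(E4, ℝ)) z = f z) {r : ℝ} (hr : 0 < r) (hrR : r < R) :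
    sphericalAverage x r f = 2 * radI r * f x := by
  have hB : ∀ s, 0 < s → s < R →
      sphericalAverage x s (Δ f : 𝓢(E4, ℝ)) = sphericalAverage x s f := fun s hs hsR =>
    sphericalAverage_congr hs.le fun z hz => hf z (hz ▸ hsR)
  have hW : ∀ s, 0 < s → s < R →
      s ^ 3 * sphericalDeriv x s f * radI s -
        sphericalAverage x s f * (s ^ 2 * besselI 2 s) = 0 := by
    intro s hs hsR
    refine eq_const_of_hasDerivAt_zero (f := fun s => s ^ 3 * sphericalDeriv x s f * radI s -
      sphericalAverage x s f * (s ^ 2 * besselI 2 s)) (R := R) ?_ ?_ hs hsR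
    · intro t ht htR
      refine (((hasDerivAt_cube_mul_sphericalDeriv x f ht).mul (hasDerivAt_radI ht.ne')).sub
        ((hasDerivAt_sphericalAverage' x t f).mul
          (hasDerivAt_cube_mul_deriv_radI ht.ne'))).congr_deriv ?_
      rw [hB t ht htR]
      field_simp
      ring
    · have h1 := continuous_sphericalDeriv x f
      have h2 := continuous_sphericalAverage x f
      have h3 := continuous_besselI 2
      have h4 := continuous_radI
      have hc : Continuous fun s => s ^ 3 * sphericalDeriv x s f * radI s -
        sphericalAverage x s f * (s ^ 2 * besselI 2 s) := by fun_prop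
      simpa using (hc.tendsto 0).mono_left (nhdsWithin_le_nhds (s := Ioi 0))
  -- hence the quotient is constant; it tends to `f x / (1/2)` at the origin
  have hq : sphericalAverage x r f / radI r = 2 * f x := by
    refine eq_const_of_hasDerivAt_zero (f := fun s => sphericalAverage x s f / radI s)
      (R := R) ?_ ?_ hr hrR
    · intro s hs hsR
      refine ((hasDerivAt_sphericalAverage' x s f).div (hasDerivAt_radI hs.ne')
        (radI_pos s).ne').congr_deriv ?_
      have h := hW s hs hsR
      have h' : sphericalDeriv x s f * radI s - sphericalAverage x s f * (besselI 2 s / s) = 0 := by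
        have hs3 : s ^ 3 ≠ 0 := by positivity
        refine (mul_eq_zero.1 (?_ : s ^ 3 * _ = 0)).resolve_left hs3
        rw [← h]
        field_simp
      rw [h', zero_div]
    · have hc : Continuous fun s => sphericalAverage x s f / radI s :=
        (continuous_sphericalAverage x f).div continuous_radI fun s => (radI_pos s).ne'
      have := (hc.tendsto 0).mono_left (nhdsWithin_le_nhds (s := Ioi 0))
      rw [sphericalAverage_zero, radI_zero] at this
      convert this using 2
      ring
  rw [div_eq_iff (radI_pos r).ne'] at hq
  rw [hq]
  ring

/-- The mean value property for a function that is smooth and satisfies `Δ g = g` in a ball only;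
it is cut off to a Schwartz function. -/
lemma sphericalAverage_eq_of_laplacian_eq_on_ball {x : E4} {g : E4 → ℝ} {R : ℝ}
    (hg : ∀ z, ‖z - x‖ < R → ContDiffAt ℝ ∞ g z) (hΔ : ∀ z, ‖z - x‖ < R → Δ g z = g z)
    {r : ℝ} (hr : 0 < r) (hrR : r < R) :
    sphericalAverage x r g = 2 * radI r * g x := by
  obtain ⟨b, hb, hbR⟩ := exists_between hrR
  obtain ⟨a, ha, hab⟩ := exists_between hb
  let χ : ContDiffBump x := ⟨a, b, hr.trans ha, hab⟩
  have hts : tsupport (fun z => χ z * g z) ⊆ Metric.closedBall x b :=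
    tsupport_mul_subset_left.trans χ.tsupport_eq.subset
  have hsmooth : ContDiff ℝ ∞ fun z => χ z * g z := by
    refine (contMDiff_of_tsupport fun z hz => ContDiffAt.contMDiffAt ?_).contDiff
    have hz' : ‖z - x‖ < R := by
      have := hts hz
      rw [Metric.mem_closedBall, dist_eq_norm] at this
      exact this.trans_lt hbR
    exact (χ.contDiff.contDiffAt).mul (hg z hz')
  have hcomp : HasCompactSupport fun z => χ z * g z :=
    (isCompact_closedBall x b).of_isClosed_subset (isClosed_tsupport _) hts
  have heq : ∀ z, ‖z - x‖ < a → (fun z => χ z * g z) =ᶠ[𝓝 z] g := by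
    intro z hz
    filter_upwards [Metric.isOpen_ball.mem_nhds
      (show z ∈ Metric.ball x a by rwa [Metric.mem_ball, dist_eq_norm])] with y hy
    rw [χ.one_of_mem_closedBall (Metric.ball_subset_closedBall hy), one_mul]
  have h := sphericalAverage_eq_of_laplacian_eq (f := hcomp.toSchwartzMap hsmooth) (R := a)
    (fun z hz => by
      rw [SchwartzMap.laplacian_apply]
      refine ((InnerProductSpace.laplacian_congr_nhds (heq z hz)).eq_of_nhds).trans ?_
      rw [hΔ z (hz.trans (hab.trans hbR))]
      exact (heq z hz).eq_of_nhds.symm) hr ha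
  have hx : hcomp.toSchwartzMap hsmooth x = g x :=
    (heq x (by simpa using hr.trans ha)).eq_of_nhds
  rw [hx] at h
  rw [← h]
  exact sphericalAverage_congr hr.le fun z hz => ((heq z (hz ▸ ha)).eq_of_nhds).symm

/-! ### Spherical averages of the solutions `I_1(|z|)/|z|` and `K_1(|z|)/|z|` -/

/-- `K_n(√q) / (√q)^n`, which satisfies `k_n' = -k_{n+1}/2`. -/
def besselKSq (n : ℕ) (q : ℝ) : ℝ := besselK n √q / √q ^ n

lemma hasDerivAt_besselKSq (n : ℕ) {q : ℝ} (hq : 0 < q) :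
    HasDerivAt (besselKSq n) (-(besselKSq (n + 1) q) / 2) q := by
  have hs : 0 < √q := Real.sqrt_pos.2 hq
  have h1 := Real.hasDerivAt_sqrt hq.ne'
  refine (((hasDerivAt_besselK n hs).comp q h1).div (h1.pow n)
    (pow_pos hs n).ne').congr_deriv ?_
  simp only [besselKSq, Function.comp_apply, Pi.pow_apply]
  rcases n with _ | n
  · simp
    field_simp
  · push_cast
    field_simp
    ring

lemma contDiffOn_besselKSq (m : ℕ) : ∀ n : ℕ, ContDiffOn ℝ m (besselKSq n) (Ioi 0) := by
  induction m with
  | zero => exact fun n => contDiffOn_zero.2 fun q hq =>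
      (hasDerivAt_besselKSq n hq).continuousAt.continuousWithinAt
  | succ m ih =>
    intro n
    push_cast
    refine (contDiffOn_succ_iff_deriv_of_isOpen isOpen_Ioi).2 ⟨fun q hq =>
      (hasDerivAt_besselKSq n hq).differentiableAt.differentiableWithinAt, by simp, ?_⟩
    refine ContDiffOn.congr (f := fun q => -(besselKSq (n + 1) q) / 2)
      ((ih (n + 1)).neg.div_const 2) fun q hq => (hasDerivAt_besselKSq n hq).deriv

lemma besselKSq_recurrence {q : ℝ} (hq : 0 < q) :
    q * besselKSq 3 q - 4 * besselKSq 2 q = besselKSq 1 q := by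
  have hs : 0 < √q := Real.sqrt_pos.2 hq
  have h := besselK_recurrence 1 hs
  norm_num at h
  have hq' : q = √q ^ 2 := (Real.sq_sqrt hq.le).symm
  simp only [besselKSq, h]
  nth_rw 1 [hq']
  field_simp
  ring

lemma radK_norm_eq (z : E4) : radK ‖z‖ = besselKSq 1 (‖z‖ ^ 2) := by
  rw [radK, besselKSq, Real.sqrt_sq (norm_nonneg z), pow_one]

lemma laplacian_radK {y z : E4} (h : z ≠ y) :
    Δ (fun z : E4 => radK ‖z - y‖) z = radK ‖z - y‖ := by
  have hq : 0 < ‖z - y‖ ^ 2 := by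
    have := norm_pos_iff.2 (sub_ne_zero.2 h)
    positivity
  simp only [radK_norm_eq]
  rw [laplacian_radial (p1 := fun q => -(besselKSq 2 q) / 2)
    (p2 := -(-(besselKSq 3 (‖z - y‖ ^ 2)) / 2) / 2) ?_ ?_]
  · rw [← besselKSq_recurrence hq]
    ring
  · filter_upwards [lt_mem_nhds hq] with q hq using hasDerivAt_besselKSq 1 hq
  · exact (hasDerivAt_besselKSq 2 hq).neg.div_const 2

lemma contDiffAt_radK {y z : E4} (h : z ≠ y) :
    ContDiffAt ℝ ∞ (fun z : E4 => radK ‖z - y‖) z := by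
  have hq : 0 < ‖z - y‖ ^ 2 := by
    have := norm_pos_iff.2 (sub_ne_zero.2 h)
    positivity
  simp only [radK_norm_eq]
  have h1 : ContDiffOn ℝ ∞ (besselKSq 1) (Ioi 0) := contDiffOn_infty.2 fun m =>
    contDiffOn_besselKSq m 1
  have h2 : ContDiff ℝ ∞ fun z : E4 => ‖z - y‖ ^ 2 := (contDiff_id.sub contDiff_const).norm_sq ℝ
  exact (h1.contDiffAt (Ioi_mem_nhds hq)).comp z h2.contDiffAt

lemma laplacian_radI (y z : E4) :
    Δ (fun z : E4 => radI ‖z - y‖) z = radI ‖z - y‖ := by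
  have hd : ∀ n q, HasDerivAt (fun q : ℝ => besselSeries n (q / 4))
      (besselSeries (n + 1) (q / 4) / 4) q := by
    intro n q
    refine ((hasDerivAt_besselSeries n (q / 4)).comp q
      ((hasDerivAt_id q).div_const 4)).congr_deriv ?_
    ring
  simp only [radI]
  rw [laplacian_radial (p := fun q => besselSeries 1 (q / 4) / 2)
    (p1 := fun q => besselSeries 2 (q / 4) / 4 / 2)
    (p2 := besselSeries 3 (‖z - y‖ ^ 2 / 4) / 4 / 4 / 2) (.of_forall fun q => (hd 1 q).div_const 2)
    (((hd 2 _).div_const 4).div_const 2), besselSeries_recurrence 1]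
  push_cast
  ring

lemma contDiff_radI (y : E4) : ContDiff ℝ ∞ fun z : E4 => radI ‖z - y‖ := by
  have h1 : ContDiff ℝ ∞ (besselSeries 1) := contDiff_infty.2 fun m => contDiff_besselSeries m 1
  have h2 : ContDiff ℝ ∞ fun z : E4 => ‖z - y‖ ^ 2 := (contDiff_id.sub contDiff_const).norm_sq ℝ
  exact (h1.comp (h2.div_const 4)).div_const 2

lemma sphericalAverage_radI (x y : E4) {r : ℝ} (hr : 0 < r) :
    sphericalAverage x r (fun z => radI ‖z - y‖) = 2 * radI r * radI ‖x - y‖ :=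
  sphericalAverage_eq_of_laplacian_eq_on_ball (R := r + 1)
    (fun _ _ => (contDiff_radI y).contDiffAt) (fun z _ => laplacian_radI y z) hr (lt_add_one r)

lemma sphericalAverage_radK_of_lt {x y : E4} {r : ℝ} (hr : 0 < r) (h : r < ‖x - y‖) :
    sphericalAverage x r (fun z => radK ‖z - y‖) = 2 * radI r * radK ‖x - y‖ := by
  have hne : ∀ z : E4, ‖z - x‖ < ‖x - y‖ → z ≠ y := by
    rintro z hz rfl
    rw [norm_sub_rev] at hz
    exact lt_irrefl _ hz
  exact sphericalAverage_eq_of_laplacian_eq_on_ball (R := ‖x - y‖)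
    (fun z hz => contDiffAt_radK (hne z hz)) (fun z hz => laplacian_radK (hne z hz)) hr h

/-- Averaging over the sphere of radius `r` a radial function centred at distance `d` is the same
as averaging over the sphere of radius `d` a radial function centred at distance `r`, since
`|r ω - d e| = |d ω - r e|` for unit vectors. -/
lemma sphericalAverage_radial_swap {x y : E4} (hxy : x ≠ y) (r : ℝ) (w : ℝ → ℝ) :
    sphericalAverage x r (fun z => w ‖z - y‖) = sphericalAverage x ‖x - y‖
      (fun z => w ‖z - (x + r • (‖x - y‖⁻¹ • (y - x)))‖) := by
  have hd : ‖x - y‖ ≠ 0 := norm_ne_zero_iff.2 (sub_ne_zero.2 hxy)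
  set d := ‖x - y‖
  set e : E4 := d⁻¹ • (y - x) with he
  have hye : y = x + d • e := by
    rw [he, smul_smul, mul_inv_cancel₀ hd, one_smul]
    abel
  have hen : ‖e‖ = 1 := by
    rw [he, norm_smul, norm_sub_rev, norm_inv, norm_norm]
    exact inv_mul_cancel₀ hd
  unfold sphericalAverage
  congr 1
  refine integral_congr_ae (.of_forall fun v => ?_)
  have hv : ‖(v : E4)‖ = 1 := by simp
  have key : ‖r • (v : E4) - d • e‖ = ‖d • (v : E4) - r • e‖ := by
    rw [← sq_eq_sq₀ (norm_nonneg _) (norm_nonneg _), norm_sub_sq_real, norm_sub_sq_real]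
    simp only [norm_smul, hv, hen, inner_smul_left, inner_smul_right, Real.norm_eq_abs, mul_one,
      sq_abs, conj_trivial]
    ring
  simp only
  rw [show x + r • (v : E4) - y = r • (v : E4) - d • e by rw [hye]; abel,
    show x + d • (v : E4) - (x + r • e) = d • (v : E4) - r • e by abel, key]

/-- For a sphere enclosing the singularity the mean value property applies after exchanging the
radius with the distance of the centers. -/
lemma sphericalAverage_radK_of_gt {x y : E4} (hxy : x ≠ y) {r : ℝ} (h : ‖x - y‖ < r) :
    sphericalAverage x r (fun z => radK ‖z - y‖) = 2 * radI ‖x - y‖ * radK r := by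
  have hd : 0 < ‖x - y‖ := norm_pos_iff.2 (sub_ne_zero.2 hxy)
  have hn : ‖x - (x + r • (‖x - y‖⁻¹ • (y - x)))‖ = r := by
    rw [sub_add_cancel_left, norm_neg, norm_smul, norm_smul, norm_inv, norm_norm, norm_sub_rev y x,
      inv_mul_cancel₀ hd.ne', mul_one, Real.norm_of_nonneg (hd.trans h).le]
  rw [sphericalAverage_radial_swap hxy, sphericalAverage_radK_of_lt hd (by rwa [hn]), hn]

/-! ### The profile of `(I - Δ) h` -/

/-- The coefficient of `I_1(r)/r` inside the sphere in `(I - Δ) h_{μ^x_ε}`, relative to that of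
`K_1(r)/r` outside. -/
def ampl (ε : ℝ) : ℝ := crossIK ε / turanI ε

/-- The profile of `(I - Δ) h_{μ^x_ε}` (up to the factor `1/(2π²)`): a multiple of the regular
solution `I_1(r)/r` inside the sphere, and the decaying solution `K_1(r)/r` outside. -/
def profile (ε r : ℝ) : ℝ := if r < ε then ampl ε * radI r else radK r

/-- The function `(I - Δ) h_{μ^x_ε}`. -/
def density (x : E4) (ε : ℝ) (z : E4) : ℝ := 1 / (2 * π ^ 2) * profile ε ‖z - x‖

lemma measurable_besselK (n : ℕ) : Measurable (besselK n) := by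
  have h : StronglyMeasurable fun p : ℝ × ℝ =>
      Real.exp (-(p.1 * Real.cosh p.2)) * Real.cosh ((n : ℝ) * p.2) := by
    refine Continuous.stronglyMeasurable ?_
    fun_prop
  exact (h.integral_prod_right' (ν := volume.restrict (Ioi 0))).measurable

lemma measurable_radK : Measurable radK := (measurable_besselK 1).div measurable_id

lemma measurable_profile (ε : ℝ) : Measurable (profile ε) :=
  Measurable.ite measurableSet_Iio (continuous_radI.measurable.const_mul _) measurable_radK

lemma cube_mul_radK {r : ℝ} (hr : r ≠ 0) : r ^ 3 * radK r = r * (r * besselK 1 r) := by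
  rw [radK]
  field_simp

lemma radK_le {r : ℝ} (hr : 0 < r) : radK r ≤ 1 / r ^ 2 := by
  have h := (mul_besselK_one_bounds hr).2
  have h1 : (1 + r) * Real.exp (-r) ≤ 1 := by
    rw [Real.exp_neg, ← div_eq_mul_inv, div_le_one (Real.exp_pos r), add_comm]
    exact Real.add_one_le_exp r
  rw [radK, div_le_div_iff₀ hr (by positivity)]
  nlinarith

lemma integrableOn_cube_mul_radK : IntegrableOn (fun r => r ^ 3 * radK r) (Ioi 0) := by
  have h1 := Real.GammaIntegral_convergent (s := 2) two_pos
  have h2 := Real.GammaIntegral_convergent (s := 3) three_pos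
  refine (h1.add h2).mono' ((measurable_id.pow_const 3).mul measurable_radK).aestronglyMeasurable ?_
  filter_upwards [ae_restrict_mem measurableSet_Ioi] with r hr
  have hr : 0 < r := hr
  rw [cube_mul_radK hr.ne', Real.norm_of_nonneg
    (mul_nonneg hr.le (mul_nonneg hr.le (besselK_pos 1 hr).le))]
  have h3 : r ^ ((2 : ℝ) - 1) = r := by norm_num
  have h4 : r ^ ((3 : ℝ) - 1) = r ^ 2 := by norm_num
  simp only [Pi.add_apply, h3, h4]
  have := mul_le_mul_of_nonneg_left (mul_besselK_one_bounds hr).2 hr.le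
  linarith

lemma exists_radI_bound (b : ℝ) : ∃ C, ∀ r, 0 ≤ r → r ≤ b → |radI r| ≤ C := by
  obtain ⟨C, hC⟩ := (isCompact_Icc (a := 0) (b := b)).exists_bound_of_continuousOn
    continuous_radI.continuousOn
  exact ⟨C, fun r h0 h1 => hC r ⟨h0, h1⟩⟩

lemma exists_profile_bound {ε : ℝ} (hε : 0 < ε) : ∃ C, ∀ r, 0 ≤ r → |profile ε r| ≤ C := by
  obtain ⟨C, hC⟩ := exists_radI_bound ε
  refine ⟨max (|ampl ε| * C) (1 / ε ^ 2), fun r hr => ?_⟩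
  unfold profile
  split_ifs with h
  · rw [abs_mul]
    exact le_max_of_le_left (mul_le_mul_of_nonneg_left (hC r hr h.le) (abs_nonneg _))
  · have hr' : 0 < r := hε.trans_le (not_lt.1 h)
    rw [abs_of_pos (radK_pos hr')]
    refine le_max_of_le_right ((radK_le hr').trans ?_)
    have := not_lt.1 h
    gcongr

lemma integrableOn_cube_mul_profile {ε : ℝ} (hε : 0 < ε) :
    IntegrableOn (fun r => r ^ 3 * profile ε r) (Ioi 0) := by
  have hm : Measurable fun r => r ^ 3 * profile ε r :=
    (measurable_id.pow_const 3).mul (measurable_profile ε)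
  obtain ⟨C, hC⟩ := exists_profile_bound hε
  rw [← Ioc_union_Ioi_eq_Ioi hε.le]
  refine IntegrableOn.union ?_ ?_
  · refine Integrable.mono' (g := fun _ => ε ^ 3 * C) (integrableOn_const (by simp))
      hm.aestronglyMeasurable ?_
    filter_upwards [ae_restrict_mem measurableSet_Ioc] with r hr
    rw [norm_mul, norm_pow, Real.norm_of_nonneg hr.1.le]
    have h0 := hr.1.le
    have h1 := hr.2
    have h2 := hC r h0
    rw [Real.norm_eq_abs]
    gcongr
  · refine (integrableOn_cube_mul_radK.mono_set (Ioi_subset_Ioi hε.le)).congr_fun ?_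
      measurableSet_Ioi
    intro r hr
    rw [mem_Ioi] at hr
    simp only [profile, if_neg (not_lt.2 hr.le)]

lemma integrable_profile (x : E4) {ε : ℝ} (hε : 0 < ε) :
    Integrable fun z : E4 => profile ε ‖z - x‖ :=
  (integrable_radial_iff x _).2 (integrableOn_cube_mul_profile hε)

lemma aestronglyMeasurable_profile (x : E4) (ε : ℝ) :
    AEStronglyMeasurable fun z : E4 => profile ε ‖z - x‖ :=
  ((measurable_profile ε).comp
    (by fun_prop : Measurable fun z : E4 => ‖z - x‖)).aestronglyMeasurable

lemma integrable_radK (y : E4) : Integrable fun z : E4 => radK ‖z - y‖ :=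
  (integrable_radial_iff y _).2 integrableOn_cube_mul_radK

lemma memLp_density (x : E4) {ε : ℝ} (hε : 0 < ε) : MemLp (density x ε) 2 := by
  have hm := aestronglyMeasurable_profile x ε
  refine MemLp.const_mul ?_ _
  rw [memLp_two_iff_integrable_sq hm]
  obtain ⟨C, hC⟩ := exists_profile_bound hε
  simp only [sq]
  exact (integrable_profile x hε).bdd_mul hm (.of_forall fun z => hC _ (norm_nonneg _))

/-! ### One-dimensional integrals -/

/-- The fundamental theorem of calculus on `(0, a)`, `(a, b)` and `(b, ∞)`, with a primitive on
each. -/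
lemma integral_Ioi_eq_three_pieces {F H₁ H₂ H₃ F₁ F₂ F₃ : ℝ → ℝ} {a b l m : ℝ} (ha : 0 < a)
    (hab : a ≤ b) (hF : IntegrableOn F (Ioi 0))
    (h₁ : ∀ r, 0 < r → HasDerivAt H₁ (F₁ r) r) (h₂ : ∀ r, 0 < r → HasDerivAt H₂ (F₂ r) r)
    (h₃ : ∀ r, 0 < r → HasDerivAt H₃ (F₃ r) r)
    (e₁ : ∀ r, 0 < r → r < a → F r = F₁ r) (e₂ : ∀ r, a < r → r < b → F r = F₂ r)
    (e₃ : ∀ r, b < r → F r = F₃ r)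
    (hl : Tendsto H₁ (𝓝[>] 0) (𝓝 l)) (hm : Tendsto H₃ atTop (𝓝 m)) :
    ∫ r in Ioi (0 : ℝ), F r = (H₁ a - l) + (H₂ b - H₂ a) + (m - H₃ b) := by
  have hb : 0 < b := ha.trans_le hab
  have hi0 : IntegrableOn F (Ioi a) := hF.mono_set (Ioi_subset_Ioi ha.le)
  have hi1 : IntervalIntegrable F volume 0 a :=
    (intervalIntegrable_iff_integrableOn_Ioc_of_le ha.le).2 (hF.mono_set Ioc_subset_Ioi_self)
  have hi2 : IntervalIntegrable F volume a b :=
    (intervalIntegrable_iff_integrableOn_Ioc_of_le hab).2 (hi0.mono_set Ioc_subset_Ioi_self)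
  have hi3 : IntegrableOn F (Ioi b) := hi0.mono_set (Ioi_subset_Ioi hab)
  have I1 : ∫ r in (0 : ℝ)..a, F r = H₁ a - l :=
    intervalIntegral.integral_eq_sub_of_hasDerivAt_of_tendsto ha
      (fun r hr => (h₁ r hr.1).congr_deriv (e₁ r hr.1 hr.2).symm) hi1 hl
      ((h₁ a ha).continuousAt.tendsto.mono_left nhdsWithin_le_nhds)
  have I2 : ∫ r in a..b, F r = H₂ b - H₂ a := by
    rcases hab.eq_or_lt with rfl | hab'
    · simp
    · exact intervalIntegral.integral_eq_sub_of_hasDerivAt_of_tendsto hab'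
        (fun r hr => (h₂ r (ha.trans hr.1)).congr_deriv (e₂ r hr.1 hr.2).symm) hi2
        ((h₂ a ha).continuousAt.tendsto.mono_left nhdsWithin_le_nhds)
        ((h₂ b hb).continuousAt.tendsto.mono_left nhdsWithin_le_nhds)
  have I3 : ∫ r in Ioi b, F r = m - H₃ b :=
    integral_Ioi_of_hasDerivAt_of_tendsto (h₃ b hb).continuousAt.continuousWithinAt
      (fun r hr => (h₃ r (hb.trans hr)).congr_deriv (e₃ r hr).symm) hi3 hm
  rw [← I1, ← I2, ← I3, intervalIntegral.integral_add_adjacent_intervals hi1 hi2,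
    intervalIntegral.integral_of_le hb.le, ← setIntegral_union (Ioc_disjoint_Ioi le_rfl)
    measurableSet_Ioi (hF.mono_set Ioc_subset_Ioi_self) hi3, Ioc_union_Ioi_eq_Ioi hb.le]

lemma tendsto_cube_mul_radK : Tendsto (fun r => r ^ 3 * radK r) atTop (𝓝 0) := by
  have h1 : Tendsto (fun r : ℝ => r * Real.exp (-r) + r ^ 2 * Real.exp (-r)) atTop (𝓝 0) := by
    simpa using (by simpa using Real.tendsto_pow_mul_exp_neg_atTop_nhds_zero 1 :
      Tendsto (fun r : ℝ => r * Real.exp (-r)) atTop (𝓝 0)).add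
      (Real.tendsto_pow_mul_exp_neg_atTop_nhds_zero 2)
  refine tendsto_of_tendsto_of_tendsto_of_le_of_le' tendsto_const_nhds h1 ?_ ?_
  · filter_upwards [eventually_gt_atTop 0] with r hr
    have := radK_pos hr
    positivity
  · filter_upwards [eventually_gt_atTop 0] with r hr
    rw [cube_mul_radK hr.ne']
    have := mul_le_mul_of_nonneg_left (mul_besselK_one_bounds hr).2 hr.le
    linarith

lemma tendsto_sq_mul_besselK_two : Tendsto (fun r => r ^ 2 * besselK 2 r) atTop (𝓝 0) := by
  have h1 : Tendsto (fun r => r ^ 3 * radK r + 2 * (r * besselK 1 r)) atTop (𝓝 0) := by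
    simpa using tendsto_cube_mul_radK.add (tendsto_mul_besselK_one_atTop.const_mul 2)
  refine tendsto_of_tendsto_of_tendsto_of_le_of_le' tendsto_const_nhds h1 ?_ ?_
  · filter_upwards [eventually_gt_atTop 0] with r hr
    have := besselK_pos 2 hr
    positivity
  · filter_upwards [eventually_gt_atTop 0] with r hr
    rw [cube_mul_radK hr.ne', besselK_two_eq hr]
    have := mul_le_mul_of_nonneg_left (besselK_zero_le_besselK_one hr) (sq_nonneg r)
    field_simp
    nlinarith

/-- The matching conditions: up to sign, `ε³` times the jumps of the derivative of `profile ε` and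
of `profile ε` itself at `r = ε` are the coefficients of `σ^x_ε` and `dσ^x_ε` in `μ^x_ε`. -/
lemma profile_jump {ε : ℝ} (hε : 0 < ε) :
    ε ^ 2 * (ampl ε * besselI 2 ε + besselK 2 ε) =
        (ε * besselI 1 ε - 2 * besselI 2 ε) / turanI ε ∧
      ε ^ 2 * (besselK 1 ε - ampl ε * besselI 1 ε) = -(ε * besselI 2 ε) / turanI ε := by
  have hT := (turanI_pos hε).ne'
  have h := bessel_wronskian hε
  have hD : turanI ε = besselI 1 ε ^ 2 - besselI 0 ε * besselI 2 ε := rfl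
  have hC : crossIK ε = besselI 1 ε * besselK 1 ε + besselI 2 ε * besselK 0 ε := rfl
  rw [ampl]
  constructor
  · field_simp
    rw [hD, hC, besselI_two_eq hε.ne', besselK_two_eq hε]
    field_simp
    linear_combination (ε ^ 2 * besselI 1 ε - 2 * ε * besselI 0 ε + 4 * besselI 1 ε) * h
  · field_simp
    rw [hD, hC, besselI_two_eq hε.ne']
    field_simp
    linear_combination (-(ε * besselI 0 ε - 2 * besselI 1 ε)) * h

end

/-! ### `μ^x_ε` as a functional of `(I - Δ) f` -/

lemma muDist_apply (x : E4) {ε : ℝ} (hε : 0 < ε) (f : 𝓢(E4, ℝ)) :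
    muDist x ε f = (ε * besselI 1 ε - 2 * besselI 2 ε) / turanI ε * sphericalAverage x ε f +
      -(ε * besselI 2 ε) / turanI ε * sphericalDeriv x ε f := by
  have h : muDist x ε f = Matrix.vecMul ![1, 1] (matB ε)⁻¹ 0 * sphericalAverage x ε f +
      Matrix.vecMul ![1, 1] (matB ε)⁻¹ 1 * deriv (fun r => sphericalAverage x r f) ε := rfl
  rw [h, vecMul_matB_inv hε, (hasDerivAt_sphericalAverage' x ε f).deriv]
  rfl

lemma integrable_schwartz_mul_profile (x : E4) {ε : ℝ} (hε : 0 < ε) (f : 𝓢(E4, ℝ)) :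
    Integrable fun z : E4 => profile ε ‖z - x‖ * f z :=
  (integrable_profile x hε).mul_bdd (c := SchwartzMap.seminorm ℝ 0 0 f)
    f.continuous.aestronglyMeasurable (.of_forall fun z => SchwartzMap.norm_le_seminorm ℝ f z)

/-- `⟨f, μ^x_ε⟩ = ∫ (I - Δ) f · density`. In polar coordinates the right side is a one-dimensional
integral, and two integrations by parts based on the Darboux equation leave only the boundary terms
at `r = ε`. -/
lemma muDist_eq_integral (x : E4) {ε : ℝ} (hε : 0 < ε) (f : 𝓢(E4, ℝ)) :
    muDist x ε f = ∫ z, oneSubLaplacian f z * density x ε z := by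
  set A : ℝ → ℝ := fun r => sphericalAverage x r f with hA
  set A' : ℝ → ℝ := fun r => sphericalDeriv x r f with hA'
  set B : ℝ → ℝ := fun r => sphericalAverage x r (Δ f : 𝓢(E4, ℝ)) with hB
  have hAc : Continuous A := continuous_sphericalAverage x f
  have hBc : Continuous B := continuous_sphericalAverage x (Δ f : 𝓢(E4, ℝ))
  have hA'c : Continuous A' := continuous_sphericalDeriv x f
  have hAd : ∀ r, HasDerivAt A (A' r) r := fun r => hasDerivAt_sphericalAverage' x r f
  have hA'd : ∀ r, 0 < r → HasDerivAt (fun r => r ^ 3 * A' r) (r ^ 3 * B r) r := fun r hr =>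
    hasDerivAt_cube_mul_sphericalDeriv x f hr
  have hpolar : ∫ z, oneSubLaplacian f z * density x ε z =
      ∫ r in Ioi (0 : ℝ), r ^ 3 * profile ε r * (A r - B r) := by
    have h1 : ∀ z, oneSubLaplacian f z * density x ε z =
        1 / (2 * π ^ 2) * (profile ε ‖z - x‖ * oneSubLaplacian f z) := fun z => by
      rw [density]; ring
    simp only [h1]
    rw [integral_const_mul, integral_eq_integral_sphericalAverage x
      (integrable_schwartz_mul_profile x hε _), ← mul_assoc]
    rw [show 1 / (2 * π ^ 2) * (2 * π ^ 2) = 1 by field_simp, one_mul]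
    refine setIntegral_congr_fun measurableSet_Ioi fun r hr => ?_
    rw [sphericalAverage_mul_radial (le_of_lt hr)]
    have : sphericalAverage x r (oneSubLaplacian f) = A r - B r :=
      sphericalAverage_sub x r f (Δ f : 𝓢(E4, ℝ))
    rw [this, mul_assoc]
  have hint : IntegrableOn (fun r => r ^ 3 * profile ε r * (A r - B r)) (Ioi 0) := by
    refine (integrableOn_cube_mul_profile hε).mul_bdd
      (c := SchwartzMap.seminorm ℝ 0 0 f + SchwartzMap.seminorm ℝ 0 0 (Δ f : 𝓢(E4, ℝ)))
      (hAc.sub hBc).aestronglyMeasurable ?_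
    filter_upwards [ae_restrict_mem measurableSet_Ioi] with r hr
    refine (norm_sub_le _ _).trans (add_le_add ?_ ?_)
    · exact abs_sphericalAverage_le (le_of_lt hr) fun z _ => SchwartzMap.norm_le_seminorm ℝ f z
    · exact abs_sphericalAverage_le (le_of_lt hr) fun z _ =>
        SchwartzMap.norm_le_seminorm ℝ (Δ f : 𝓢(E4, ℝ)) z
  have hd1 : ∀ r, 0 < r → HasDerivAt
      (fun r => ampl ε * (A r * (r ^ 2 * besselI 2 r) - r ^ 3 * A' r * radI r))
      (r ^ 3 * (ampl ε * radI r) * (A r - B r)) r := by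
    intro r hr
    refine ((((hAd r).mul (hasDerivAt_cube_mul_deriv_radI hr.ne')).sub
      ((hA'd r hr).mul (hasDerivAt_radI hr.ne'))).const_mul (ampl ε)).congr_deriv ?_
    field_simp
    ring
  have hd3 : ∀ r, 0 < r → HasDerivAt
      (fun r => A r * (-(r ^ 2 * besselK 2 r)) - r ^ 3 * A' r * radK r)
      (r ^ 3 * radK r * (A r - B r)) r := by
    intro r hr
    refine (((hAd r).mul (hasDerivAt_cube_mul_deriv_radK hr)).sub
      ((hA'd r hr).mul (hasDerivAt_radK hr))).congr_deriv ?_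
    field_simp
    ring
  have hl : Tendsto (fun r => ampl ε * (A r * (r ^ 2 * besselI 2 r) - r ^ 3 * A' r * radI r))
      (𝓝[>] 0) (𝓝 0) := by
    have h3 := continuous_besselI 2
    have h4 := continuous_radI
    have hc : Continuous fun r =>
      ampl ε * (A r * (r ^ 2 * besselI 2 r) - r ^ 3 * A' r * radI r) := by fun_prop
    simpa using (hc.tendsto 0).mono_left (nhdsWithin_le_nhds (s := Ioi 0))
  have hm : Tendsto (fun r => A r * (-(r ^ 2 * besselK 2 r)) - r ^ 3 * A' r * radK r)
      atTop (𝓝 0) := by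
    have t1 : Tendsto (fun r => A r * (-(r ^ 2 * besselK 2 r))) atTop (𝓝 0) := by
      have h0 : Tendsto (fun r => -(r ^ 2 * besselK 2 r)) atTop (𝓝 0) := by
        simpa using tendsto_sq_mul_besselK_two.neg
      have hb : IsBoundedUnder (· ≤ ·) atTop (norm ∘ A) := by
        refine isBoundedUnder_of_eventually_le (a := SchwartzMap.seminorm ℝ 0 0 f) ?_
        filter_upwards [eventually_ge_atTop 0] with r hr
        exact abs_sphericalAverage_le hr fun z _ => SchwartzMap.norm_le_seminorm ℝ f z
      exact (h0.zero_mul_isBoundedUnder_le hb).congr fun r => mul_comm _ _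
    have t2 : Tendsto (fun r => r ^ 3 * A' r * radK r) atTop (𝓝 0) := by
      have hb : IsBoundedUnder (· ≤ ·) atTop (norm ∘ A') :=
        isBoundedUnder_of_eventually_le (a := SchwartzMap.seminorm ℝ 0 1 f)
          (.of_forall fun r => abs_sphericalDeriv_le x r f)
      exact (tendsto_cube_mul_radK.zero_mul_isBoundedUnder_le hb).congr fun r => by ring
    simpa using t1.sub t2
  -- only two pieces are needed here: the middle interval is degenerate
  have h := integral_Ioi_eq_three_pieces hε le_rfl hint hd1 hd1 hd3
    (fun r _ hr => by simp only [profile, if_pos hr])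
    (fun r h1 h2 => absurd (h1.trans h2) (lt_irrefl _))
    (fun r hr => by simp only [profile, if_neg (not_lt.2 hr.le)]) hl hm
  obtain ⟨j1, j2⟩ := profile_jump hε
  rw [hpolar, h, muDist_apply x hε, ← j1, ← j2, radI_eq hε.ne', radK]
  field_simp
  ring

/-! ### Inner products of densities -/

lemma integral_density_mul_density (x y : E4) (ε₁ ε₂ : ℝ) :
    ∫ z, density x ε₁ z * density y ε₂ z =
      1 / (4 * π ^ 4) * ∫ z : E4, profile ε₁ ‖z - x‖ * profile ε₂ ‖z - y‖ := by
  rw [← integral_const_mul]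
  refine integral_congr_ae (.of_forall fun z => ?_)
  simp only [density]
  field_simp
  ring

lemma hasDerivAt_half_sq_mul_turanI (c : ℝ) {r : ℝ} (hr : 0 < r) :
    HasDerivAt (fun r => c / 2 * (r ^ 2 * turanI r)) (r ^ 3 * (c * radI r * radI r)) r := by
  refine ((hasDerivAt_sq_mul_turanI hr.ne').const_mul (c / 2)).congr_deriv ?_
  rw [radI_eq hr.ne']
  field_simp

lemma hasDerivAt_half_sq_mul_crossIK (c : ℝ) {r : ℝ} (hr : 0 < r) :
    HasDerivAt (fun r => c / 2 * (r ^ 2 * crossIK r)) (r ^ 3 * (c * radI r * radK r)) r := by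
  refine ((hasDerivAt_sq_mul_crossIK hr).const_mul (c / 2)).congr_deriv ?_
  rw [radI_eq hr.ne', radK]
  field_simp

lemma hasDerivAt_half_sq_mul_turanK (c : ℝ) {r : ℝ} (hr : 0 < r) :
    HasDerivAt (fun r => -(c / 2) * (r ^ 2 * turanK r)) (r ^ 3 * (c * radK r * radK r)) r := by
  refine ((hasDerivAt_sq_mul_turanK hr).const_mul (-(c / 2))).congr_deriv ?_
  rw [radK]
  field_simp

lemma tendsto_half_sq_mul_turanI (c : ℝ) :
    Tendsto (fun r => c / 2 * (r ^ 2 * turanI r)) (𝓝[>] 0) (𝓝 0) := by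
  simpa using tendsto_sq_mul_turanI.const_mul (c / 2)

lemma tendsto_half_sq_mul_turanK (c : ℝ) :
    Tendsto (fun r => -(c / 2) * (r ^ 2 * turanK r)) atTop (𝓝 0) := by
  simpa using tendsto_sq_mul_turanK.const_mul (-(c / 2))

lemma ampl_mul_turanI {ε : ℝ} (hε : 0 < ε) : ampl ε * turanI ε = crossIK ε :=
  div_mul_cancel₀ _ (turanI_pos hε).ne'

/-- The boundary terms at `r = ε` in the integral of `r³ (profile ε)²`; the right side is
`4π² G(ε)`. -/
lemma sq_mul_turanK_add {ε : ℝ} (hε : 0 < ε) :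
    ε ^ 2 * (ampl ε * crossIK ε + turanK ε) = 1 / turanI ε - 2 * ampl ε := by
  have hT := (turanI_pos hε).ne'
  have h := turan_identity hε
  rw [ampl]
  field_simp
  linear_combination h

/-- Concentric spheres: the terms that depend on the smaller radius cancel. -/
lemma integral_density_mul_density_concentric (x : E4) {ε₁ ε₂ : ℝ} (h₂ : 0 < ε₂) (h : ε₂ ≤ ε₁) :
    ∫ z, density x ε₁ z * density x ε₂ z = G ε₁ := by
  have h₁ : 0 < ε₁ := h₂.trans_le h
  obtain ⟨C, hC⟩ := exists_profile_bound h₁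
  have hint : IntegrableOn (fun r => r ^ 3 * (profile ε₁ r * profile ε₂ r)) (Ioi 0) := by
    have := (integrableOn_cube_mul_profile h₂).bdd_mul (f := profile ε₁) (c := C)
      (measurable_profile ε₁).aestronglyMeasurable
      ((ae_restrict_mem measurableSet_Ioi).mono fun r hr => hC r (le_of_lt hr))
    refine this.congr (.of_forall fun r => ?_)
    simp only
    ring
  -- the integrand is a multiple of `(I_1/r)²`, of `(I_1/r)(K_1/r)` and of `(K_1/r)²` on the pieces
  have hI := integral_Ioi_eq_three_pieces h₂ h hint
    (fun r hr => hasDerivAt_half_sq_mul_turanI (ampl ε₁ * ampl ε₂) hr)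
    (fun r hr => hasDerivAt_half_sq_mul_crossIK (ampl ε₁) hr)
    (fun r hr => hasDerivAt_half_sq_mul_turanK 1 hr)
    (fun r _ hr => by
      simp only [profile, if_pos hr, if_pos (hr.trans_le h)]; ring)
    (fun r hr1 hr2 => by
      simp only [profile, if_pos hr2, if_neg (not_lt.2 hr1.le)])
    (fun r hr => by
      simp only [profile, if_neg (not_lt.2 hr.le), if_neg (not_lt.2 (h.trans hr.le))]; ring)
    (tendsto_half_sq_mul_turanI _) (tendsto_half_sq_mul_turanK _)
  rw [integral_density_mul_density,
    integral_radial x (w := fun r => profile ε₁ r * profile ε₂ r) hint, hI, G_eq]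
  have e1 := ampl_mul_turanI h₂
  have e2 := sq_mul_turanK_add h₁
  have e3 : (1 - 2 * crossIK ε₁) / turanI ε₁ = 1 / turanI ε₁ - 2 * ampl ε₁ := by
    rw [ampl]; ring
  rw [e3, ← e2]
  field_simp
  linear_combination (ampl ε₁ * ε₂ ^ 2) * e1

/-- Replacing `profile ε` by `K_1(r)/r` does not change the pairing with a function whose spherical
averages are `2 I_1(r)/r · c` inside the sphere: `profile ε - K_1(r)/r` is supported in the ball and
orthogonal to the solutions of `Δ u = u` there. -/
lemma integral_mul_profile_eq {y : E4} {ε c : ℝ} (hε : 0 < ε) {P : E4 → ℝ}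
    (hP : AEStronglyMeasurable P) {M : ℝ} (hM : ∀ z, |P z| ≤ M)
    (hc : ∀ r, 0 < r → r < ε → sphericalAverage y r P = 2 * radI r * c) :
    ∫ z, P z * profile ε ‖z - y‖ = ∫ z, radK ‖z - y‖ * P z := by
  have i1 : Integrable fun z => P z * profile ε ‖z - y‖ :=
    (integrable_profile y hε).bdd_mul hP (.of_forall hM)
  have i2 : Integrable fun z => radK ‖z - y‖ * P z :=
    (integrable_radK y).mul_bdd hP (.of_forall hM)
  rw [← sub_eq_zero, ← integral_sub i1 i2]
  have e : ∀ z, P z * profile ε ‖z - y‖ - radK ‖z - y‖ * P z =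
      (fun r => profile ε r - radK r) ‖z - y‖ * P z := fun z => by ring
  have i3 := i1.sub i2
  simp only [Pi.sub_def, e] at i3
  simp only [e]
  rw [integral_eq_integral_sphericalAverage y i3, mul_eq_zero]
  right
  obtain ⟨C, hC⟩ := exists_radI_bound ε
  -- outside the sphere the first factor vanishes; `min r ε` only keeps the second one bounded
  have hint : IntegrableOn (fun r => (r ^ 3 * profile ε r - r ^ 3 * radK r) *
      (2 * radI (min r ε) * c)) (Ioi 0) := by
    refine ((integrableOn_cube_mul_profile hε).sub integrableOn_cube_mul_radK).mul_bdd
      (c := 2 * C * |c|) ?_ ?_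
    · have := continuous_radI
      exact Continuous.aestronglyMeasurable (by fun_prop)
    · filter_upwards [ae_restrict_mem measurableSet_Ioi] with r hr
      have hr : 0 < r := hr
      rw [norm_mul, norm_mul, Real.norm_eq_abs, Real.norm_eq_abs, Real.norm_eq_abs, abs_two]
      have := hC (min r ε) (le_min hr.le hε.le) (min_le_right _ _)
      gcongr
  have hI := integral_Ioi_eq_three_pieces hε le_rfl hint
    (fun r hr => (hasDerivAt_half_sq_mul_turanI (2 * c * ampl ε) hr).sub
      (hasDerivAt_half_sq_mul_crossIK (2 * c) hr))
    (fun r hr => hasDerivAt_half_sq_mul_turanI 1 hr) (fun r _ => hasDerivAt_const r 0)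
    (fun r _ hr => by
      simp only [profile, if_pos hr, min_eq_left hr.le]; ring)
    (fun r h1 h2 => absurd (h1.trans h2) (lt_irrefl _))
    (fun r hr => by
      simp only [profile, if_neg (not_lt.2 hr.le)]; ring)
    ((tendsto_half_sq_mul_turanI _).sub
      (by simpa using tendsto_sq_mul_crossIK.const_mul (2 * c / 2))) tendsto_const_nhds
  have e1 := ampl_mul_turanI hε
  refine Eq.trans (setIntegral_congr_fun measurableSet_Ioi fun r hr => ?_) (hI.trans ?_)
  · have hr : 0 < r := hr
    rw [sphericalAverage_mul_radial hr.le P fun r => profile ε r - radK r]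
    rcases lt_or_ge r ε with h | h
    · rw [hc r hr h, min_eq_left h.le]
      ring
    · simp only [profile, if_neg (not_lt.2 h)]
      ring
  · simp only [Pi.sub_apply]
    linear_combination (c * ε ^ 2) * e1

/-- The pairing of `profile ε` about `x` with `K_1(|z - y|)/|z - y|` in polar coordinates about `x`.
The average of the latter over `S_r(x)` is symmetric in `r` and `d = |x - y|`, hence the minimum and
the maximum. -/
lemma integral_radK_mul_profile {x y : E4} (hxy : x ≠ y) {ε : ℝ} (hε : 0 < ε) :
    IntegrableOn (fun r => r ^ 3 * profile ε r *
      (2 * radI (min r ‖x - y‖) * radK (max r ‖x - y‖))) (Ioi 0) ∧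
    ∫ z, radK ‖z - y‖ * profile ε ‖z - x‖ = 2 * π ^ 2 * ∫ r in Ioi (0 : ℝ),
      r ^ 3 * profile ε r * (2 * radI (min r ‖x - y‖) * radK (max r ‖x - y‖)) := by
  have hd : 0 < ‖x - y‖ := norm_pos_iff.2 (sub_ne_zero.2 hxy)
  set d := ‖x - y‖
  constructor
  · obtain ⟨C, hC⟩ := exists_radI_bound d
    have hC0 : 0 ≤ C := (abs_nonneg _).trans (hC 0 le_rfl hd.le)
    refine (integrableOn_cube_mul_profile hε).mul_bdd (c := 2 * C * (1 / d ^ 2)) ?_ ?_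
    · have h1 := continuous_radI.measurable
      have h2 := measurable_radK
      exact Measurable.aestronglyMeasurable (by fun_prop)
    · filter_upwards [ae_restrict_mem measurableSet_Ioi] with r hr
      have hr : 0 < r := hr
      have hm : 0 < max r d := lt_max_of_lt_left hr
      rw [norm_mul, norm_mul, Real.norm_eq_abs, Real.norm_eq_abs, Real.norm_eq_abs, abs_two,
        abs_of_pos (radK_pos hm)]
      have h1 := hC (min r d) (le_min hr.le hd.le) (min_le_right _ _)
      have h2 : radK (max r d) ≤ 1 / d ^ 2 := by
        refine (radK_le hm).trans ?_
        have := le_max_right r d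
        gcongr
      have := (radK_pos hm).le
      gcongr
  · obtain ⟨M, hM⟩ := exists_profile_bound hε
    have hi : Integrable fun z : E4 => profile ε ‖z - x‖ * radK ‖z - y‖ :=
      (integrable_radK y).bdd_mul (aestronglyMeasurable_profile x ε)
        (.of_forall fun z => hM _ (norm_nonneg _))
    simp only [mul_comm (radK _)]
    rw [integral_eq_integral_sphericalAverage x hi]
    congr 1
    refine integral_congr_ae ?_
    have hne : ∀ᵐ r ∂(volume.restrict (Ioi (0 : ℝ))), r ≠ d :=
      ae_restrict_of_ae (by simp [ae_iff])
    filter_upwards [ae_restrict_mem measurableSet_Ioi, hne] with r hr hrd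
    have hr : 0 < r := hr
    rw [sphericalAverage_mul_radial hr.le, mul_assoc]
    rcases lt_or_gt_of_ne hrd with h | h
    · rw [sphericalAverage_radK_of_lt hr h, min_eq_left h.le, max_eq_right h.le]
    · rw [sphericalAverage_radK_of_gt hxy h, min_eq_right h.le, max_eq_left h.le]

/-- Nested balls: on the ball about `y` the density about `x` is a multiple of the regular solution
`I_1(|z - x|)/|z - x|`. -/
lemma integral_density_mul_density_nested {x y : E4} (hxy : x ≠ y) {ε₁ ε₂ : ℝ} (h₁ : 0 < ε₁)
    (h₂ : 0 < ε₂) (h : ‖x - y‖ + ε₂ < ε₁) :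
    ∫ z, density x ε₁ z * density y ε₂ z =
      besselI 0 ‖x - y‖ * G ε₁ -
        (1 / (4 * π ^ 2)) * (besselI 2 ‖x - y‖ / turanI ε₁) := by
  have hd : 0 < ‖x - y‖ := norm_pos_iff.2 (sub_ne_zero.2 hxy)
  obtain ⟨M, hM⟩ := exists_profile_bound h₁
  obtain ⟨hint, hI⟩ := integral_radK_mul_profile hxy h₁
  have hmv : ∀ r, 0 < r → r < ε₂ → sphericalAverage y r (fun z => profile ε₁ ‖z - x‖) =
      2 * radI r * (ampl ε₁ * radI ‖y - x‖) := by
    intro r hr hr2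
    rw [sphericalAverage_congr (g := fun z => ampl ε₁ * radI ‖z - x‖) hr.le,
      sphericalAverage_const_mul, sphericalAverage_radI y x hr]
    · ring
    · intro z hz
      have : ‖z - x‖ < ε₁ := by
        have := norm_sub_le_norm_sub_add_norm_sub z y x
        rw [norm_sub_rev y x] at this
        linarith
      rw [profile, if_pos this]
  rw [integral_density_mul_density, integral_mul_profile_eq h₂ (aestronglyMeasurable_profile x ε₁)
    (fun z => hM _ (norm_nonneg _)) hmv, hI]
  set d := ‖x - y‖
  have hdε : d < ε₁ := by linarith
  rw [integral_Ioi_eq_three_pieces hd hdε.le hint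
    (fun r hr => hasDerivAt_half_sq_mul_turanI (2 * ampl ε₁ * radK d) hr)
    (fun r hr => hasDerivAt_half_sq_mul_crossIK (2 * ampl ε₁ * radI d) hr)
    (fun r hr => hasDerivAt_half_sq_mul_turanK (2 * radI d) hr)
    (fun r _ hr => by
      simp only [profile, if_pos (hr.trans hdε), min_eq_left hr.le, max_eq_right hr.le]; ring)
    (fun r hr1 hr2 => by
      simp only [profile, if_pos hr2, min_eq_right hr1.le, max_eq_left hr1.le]; ring)
    (fun r hr => by
      simp only [profile, if_neg (not_lt.2 hr.le), min_eq_right (hdε.trans hr).le,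
        max_eq_left (hdε.trans hr).le]; ring)
    (tendsto_half_sq_mul_turanI _) (tendsto_half_sq_mul_turanK _), G_eq]
  have e2 := sq_mul_turanK_add h₁
  have e3 : (1 - 2 * crossIK ε₁) / turanI ε₁ = 1 / turanI ε₁ - 2 * ampl ε₁ := by
    rw [ampl]; ring
  have hw := bessel_wronskian hd
  have e4 : d ^ 2 * (radK d * turanI d - radI d * crossIK d) = -besselI 2 d := by
    rw [radI_eq hd.ne', radK, turanI, crossIK]
    field_simp
    linear_combination (-besselI 2 d) * hw
  have e5 : besselI 2 d = besselI 0 d - 2 * radI d := by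
    rw [besselI_two_eq hd.ne', radI_eq hd.ne']; ring
  rw [e3, div_eq_mul_one_div (besselI 2 d)]
  field_simp
  linear_combination (2 * radI d) * e2 + (2 * ampl ε₁) * e4 +
    (1 / turanI ε₁ - 2 * ampl ε₁) * e5

/-- Disjoint balls: on the ball about `y` the density about `x` is the decaying solution
`(2π²)⁻¹ K_1(|z - x|)/|z - x|`. -/
lemma integral_density_mul_density_disjoint {x y : E4} (hxy : x ≠ y) {ε₁ ε₂ : ℝ} (h₁ : 0 < ε₁)
    (h₂ : 0 < ε₂) (h : ε₁ + ε₂ < ‖x - y‖) :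
    ∫ z, density x ε₁ z * density y ε₂ z = (1 / (2 * π ^ 2)) * besselK 0 ‖x - y‖ := by
  have hd : 0 < ‖x - y‖ := norm_pos_iff.2 (sub_ne_zero.2 hxy)
  obtain ⟨M, hM⟩ := exists_profile_bound h₁
  obtain ⟨hint, hI⟩ := integral_radK_mul_profile hxy h₁
  have hmv : ∀ r, 0 < r → r < ε₂ → sphericalAverage y r (fun z => profile ε₁ ‖z - x‖) =
      2 * radI r * radK ‖y - x‖ := by
    intro r hr hr2
    rw [sphericalAverage_congr (g := fun z => radK ‖z - x‖) hr.le,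
      sphericalAverage_radK_of_lt hr (by rw [norm_sub_rev]; linarith)]
    intro z hz
    have : ε₁ < ‖z - x‖ := by
      have := norm_sub_le_norm_sub_add_norm_sub x z y
      rw [norm_sub_rev x z] at this
      linarith
    rw [profile, if_neg (not_lt.2 this.le)]
  rw [integral_density_mul_density, integral_mul_profile_eq h₂ (aestronglyMeasurable_profile x ε₁)
    (fun z => hM _ (norm_nonneg _)) hmv, hI]
  set d := ‖x - y‖
  have hdε : ε₁ < d := by linarith
  rw [integral_Ioi_eq_three_pieces h₁ hdε.le hint
    (fun r hr => hasDerivAt_half_sq_mul_turanI (2 * ampl ε₁ * radK d) hr)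
    (fun r hr => hasDerivAt_half_sq_mul_crossIK (2 * radK d) hr)
    (fun r hr => hasDerivAt_half_sq_mul_turanK (2 * radI d) hr)
    (fun r _ hr => by
      simp only [profile, if_pos hr, min_eq_left (hr.trans hdε).le, max_eq_right (hr.trans hdε).le]
      ring)
    (fun r hr1 hr2 => by
      simp only [profile, if_neg (not_lt.2 hr1.le), min_eq_left hr2.le, max_eq_right hr2.le]; ring)
    (fun r hr => by
      simp only [profile, if_neg (not_lt.2 (hdε.trans hr).le), min_eq_right hr.le,
        max_eq_left hr.le]; ring)
    (tendsto_half_sq_mul_turanI _) (tendsto_half_sq_mul_turanK _)]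
  have e1 := ampl_mul_turanI h₁
  have hw := bessel_wronskian hd
  have e4 : d ^ 2 * (radK d * crossIK d + radI d * turanK d) = besselK 0 d := by
    rw [radI_eq hd.ne', radK, turanK, crossIK, besselI_two_eq hd.ne', besselK_two_eq hd]
    field_simp
    linear_combination (besselK 0 d) * hw
  field_simp
  linear_combination (4 * radK d * ε₁ ^ 2) * e1 + 4 * e4

/-! ### The operator `I - Δ` and the representation of the dual of `H²` -/

/-- The symbol of `(I - Δ)⁻¹` has temperate growth. -/
lemma hasTemperateGrowth_besselSymbol :
    (fun ξ : E4 => (1 + ‖(2 * π) • ξ‖ ^ 2) ^ (-1 : ℝ)).HasTemperateGrowth := by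
  have h := (Function.hasTemperateGrowth_one_add_norm_sq_rpow E4 (-1)).comp
    ((2 * π) • ContinuousLinearMap.id ℝ E4).hasTemperateGrowth
  exact h

/-- `I - Δ` maps the complex Schwartz space onto itself: the inverse is the Fourier multiplier
with symbol `(1 + |2πξ|²)⁻¹`. -/
lemma exists_sub_laplacian_eq (g : 𝓢(E4, ℂ)) : ∃ f : 𝓢(E4, ℂ), f - Δ f = g := by
  set m : E4 → ℝ := fun ξ => (1 + ‖(2 * π) • ξ‖ ^ 2) ^ (-1 : ℝ) with hm
  have hmg : m.HasTemperateGrowth := hasTemperateGrowth_besselSymbol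
  have hsq : (fun ξ : E4 => ‖ξ‖ ^ 2).HasTemperateGrowth := by fun_prop
  refine ⟨SchwartzMap.fourierMultiplierCLM ℂ m g, ?_⟩
  rw [SchwartzMap.laplacian_eq_fourierMultiplierCLM,
    SchwartzMap.fourierMultiplierCLM_fourierMultiplierCLM_apply hsq hmg, neg_smul, sub_neg_eq_add,
    SchwartzMap.fourierMultiplierCLM_apply, SchwartzMap.fourierMultiplierCLM_apply,
    ← FourierTransform.fourierInv_smul, ← FourierTransform.fourierInv_add]
  have hg : FourierTransform.fourierInv (FourierTransform.fourier g) = g :=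
    FourierTransform.fourierInv_fourier_eq g
  refine Eq.trans (congrArg _ ?_) hg
  ext ξ
  simp only [add_apply, smul_apply]
  rw [SchwartzMap.smulLeftCLM_apply_apply hmg, SchwartzMap.smulLeftCLM_apply_apply (hsq.mul hmg),
    smul_smul, ← add_smul]
  have hpos : (0 : ℝ) < 1 + ‖(2 * π) • ξ‖ ^ 2 := by positivity
  have : m ξ + (2 * π) ^ 2 * ((fun ξ : E4 => ‖ξ‖ ^ 2) * m) ξ = 1 := by
    have h1 : (2 * π) ^ 2 * ‖ξ‖ ^ 2 = ‖(2 * π) • ξ‖ ^ 2 := by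
      rw [norm_smul, Real.norm_eq_abs, mul_pow |2 * π|, sq_abs]
    simp only [Pi.mul_apply]
    rw [← mul_assoc, h1, hm]
    simp only [Real.rpow_neg_one]
    field_simp
  rw [this, one_smul]

lemma laplacian_postcompCLM {F F' : Type*} [NormedAddCommGroup F] [NormedSpace ℝ F]
    [NormedAddCommGroup F'] [NormedSpace ℝ F'] (L : F →L[ℝ] F') (f : 𝓢(E4, F)) :
    Δ (f.postcompCLM L) = (Δ f).postcompCLM L := by
  ext z
  rw [SchwartzMap.laplacian_apply, SchwartzMap.postcompCLM_apply, SchwartzMap.laplacian_apply]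
  exact ((f.smooth 2).contDiffAt).laplacian_CLM_comp_left (l := L)

/-- The real solution is the real part of the complex one. -/
lemma oneSubLaplacian_surjective : Function.Surjective oneSubLaplacian := by
  intro g
  obtain ⟨f, hf⟩ := exists_sub_laplacian_eq (g.postcompCLM Complex.ofRealCLM)
  refine ⟨f.postcompCLM Complex.reCLM, ?_⟩
  rw [oneSubLaplacian, laplacian_postcompCLM, ← map_sub, hf]
  ext z
  simp

/-- The map `f ↦ (I - Δ) f` from Schwartz functions to `L²`. -/
def oneSubLaplacianL2 : 𝓢(E4, ℝ) →ₗ[ℝ] Lp ℝ 2 (volume : Measure E4) where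
  toFun f := SchwartzMap.toLpCLM ℝ ℝ 2 volume (oneSubLaplacian f)
  map_add' f g := by rw [oneSubLaplacian_add, map_add]
  map_smul' c f := by rw [oneSubLaplacian_smul, map_smul, RingHom.id_apply]

lemma coeFn_oneSubLaplacianL2 (f : 𝓢(E4, ℝ)) :
    oneSubLaplacianL2 f =ᵐ[volume] oneSubLaplacian f :=
  (oneSubLaplacian f).coeFn_toLp 2 volume

lemma inner_oneSubLaplacianL2 (f g : 𝓢(E4, ℝ)) :
    inner ℝ (oneSubLaplacianL2 f) (oneSubLaplacianL2 g) = inner ℝ (toH2 f) (toH2 g) := by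
  rw [inner_toH2, L2.inner_def]
  refine Eq.trans (integral_congr_ae ?_) (sobolevInner_eq f g).symm
  filter_upwards [coeFn_oneSubLaplacianL2 f, coeFn_oneSubLaplacianL2 g] with z h1 h2
  rw [h1, h2, RCLike.inner_apply, conj_trivial, mul_comm]

lemma norm_oneSubLaplacianL2 (f : 𝓢(E4, ℝ)) : ‖oneSubLaplacianL2 f‖ = ‖toH2 f‖ := by
  rw [← sq_eq_sq₀ (norm_nonneg _) (norm_nonneg _), ← real_inner_self_eq_norm_sq,
    ← real_inner_self_eq_norm_sq, inner_oneSubLaplacianL2]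

lemma denseRange_oneSubLaplacianL2 : DenseRange oneSubLaplacianL2 := by
  have h : DenseRange (SchwartzMap.toLpCLM ℝ ℝ 2 (volume : Measure E4)) :=
    SchwartzMap.denseRange_toLpCLM (by simp)
  rwa [DenseRange, ← oneSubLaplacian_surjective.range_comp] at h

/-- The isometry `H² → L²` that extends `f ↦ (I - Δ) f` from Schwartz functions. -/
def sobolevToL2 : H2 →L[ℝ] Lp ℝ 2 (volume : Measure E4) :=
  oneSubLaplacianL2.extendOfNorm toH2

lemma sobolevToL2_toH2 (f : 𝓢(E4, ℝ)) : sobolevToL2 (toH2 f) = oneSubLaplacianL2 f :=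
  LinearMap.extendOfNorm_eq denseRange_toH2
    ⟨1, fun f => by rw [one_mul, norm_oneSubLaplacianL2]⟩ f

lemma inner_sobolevToL2 (h k : H2) :
    inner ℝ (sobolevToL2 h) (sobolevToL2 k) = inner ℝ h k := by
  have hn : ∀ h, ‖sobolevToL2 h‖ = ‖h‖ := fun h =>
    denseRange_toH2.induction_on (p := fun h => ‖sobolevToL2 h‖ = ‖h‖) h
      (isClosed_eq (by fun_prop) (by fun_prop)) fun f => by
        rw [sobolevToL2_toH2, norm_oneSubLaplacianL2]
  exact LinearIsometry.inner_map_map ⟨sobolevToL2.toLinearMap, hn⟩ h k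

lemma apply_eq_inner_toLp {ν : TempDist} {w : E4 → ℝ} (hw : MemLp w 2)
    (h : ∀ f, ν f = ∫ z, oneSubLaplacian f z * w z) (f : 𝓢(E4, ℝ)) :
    ν f = inner ℝ (oneSubLaplacianL2 f) (hw.toLp w) := by
  rw [h, L2.inner_def]
  refine integral_congr_ae ?_
  filter_upwards [coeFn_oneSubLaplacianL2 f, hw.coeFn_toLp] with z h1 h2
  rw [h1, h2, RCLike.inner_apply, conj_trivial, mul_comm]

/-- A distribution of the form `f ↦ ∫ (I - Δ) f · w` with `w ∈ L²` belongs to `H⁻²`. -/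
lemma memHNegTwo_of_eq_integral {ν : TempDist} {w : E4 → ℝ} (hw : MemLp w 2)
    (h : ∀ f, ν f = ∫ z, oneSubLaplacian f z * w z) : MemHNegTwo ν := by
  refine ⟨‖hw.toLp w‖, fun f => ?_⟩
  rw [apply_eq_inner_toLp hw h, mul_comm, ← norm_oneSubLaplacianL2]
  exact abs_real_inner_le_norm _ _

/-- If `ν f = ∫ (I - Δ) f · w`, then the isometry `I - Δ : H² → L²` sends `h_ν` to `w`. -/
lemma sobolevToL2_hRep {ν : TempDist} {w : E4 → ℝ} (hw : MemLp w 2)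
    (h : ∀ f, ν f = ∫ z, oneSubLaplacian f z * w z) : sobolevToL2 (hRep ν) = hw.toLp w := by
  refine denseRange_oneSubLaplacianL2.eq_of_inner_right (𝕜 := ℝ) fun f => ?_
  rw [← apply_eq_inner_toLp hw h, ← sobolevToL2_toH2, inner_sobolevToL2,
    inner_hRep (memHNegTwo_of_eq_integral hw h)]

lemma inner_hRep_hRep {ν₁ ν₂ : TempDist} {w₁ w₂ : E4 → ℝ} (hw₁ : MemLp w₁ 2) (hw₂ : MemLp w₂ 2)
    (h₁ : ∀ f, ν₁ f = ∫ z, oneSubLaplacian f z * w₁ z)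
    (h₂ : ∀ f, ν₂ f = ∫ z, oneSubLaplacian f z * w₂ z) :
    inner ℝ (hRep ν₁) (hRep ν₂) = ∫ z, w₁ z * w₂ z := by
  rw [← inner_sobolevToL2, sobolevToL2_hRep hw₁ h₁, sobolevToL2_hRep hw₂ h₂, L2.inner_def]
  refine integral_congr_ae ?_
  filter_upwards [hw₁.coeFn_toLp, hw₂.coeFn_toLp] with z h1 h2
  rw [h1, h2, RCLike.inner_apply, conj_trivial, mul_comm]

lemma memHNegTwo_muDist (x : E4) {ε : ℝ} (hε : 0 < ε) : MemHNegTwo (muDist x ε) :=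
  memHNegTwo_of_eq_integral (memLp_density x hε) (muDist_eq_integral x hε)

lemma inner_hRep_muDist (x y : E4) {ε₁ ε₂ : ℝ} (h₁ : 0 < ε₁) (h₂ : 0 < ε₂) :
    inner ℝ (hRep (muDist x ε₁)) (hRep (muDist y ε₂)) =
      ∫ z, density x ε₁ z * density y ε₂ z :=
  inner_hRep_hRep (memLp_density x h₁) (memLp_density y h₂) (muDist_eq_integral x h₁)
    (muDist_eq_integral y h₂)

/-! ### Paley-Wiener integrals as a centered Gaussian process -/

lemma norm_exp_I_mul_sub_le (a b : ℝ) :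
    ‖Complex.exp (a * Complex.I) - Complex.exp (b * Complex.I)‖ ≤ |a - b| := by
  have h := Real.norm_exp_I_mul_ofReal_sub_one_le (x := a - b)
  have : Complex.exp (a * Complex.I) - Complex.exp (b * Complex.I) =
      Complex.exp (b * Complex.I) * (Complex.exp (Complex.I * ((a - b : ℝ) : ℂ)) - 1) := by
    rw [mul_sub, ← Complex.exp_add]
    push_cast
    ring_nf
  rw [this, norm_mul, Complex.norm_exp_ofReal_mul_I, one_mul]
  exact h

/-- The characteristic function of an `L²` random variable is continuous in the variable. -/
lemma continuous_integral_exp_I_mul {Ω : Type*} [MeasurableSpace Ω] {P : Measure Ω}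
    [IsProbabilityMeasure P] (t : ℝ) :
    Continuous fun X : Lp ℝ 2 P => ∫ v, Complex.exp ((t * X v : ℝ) * Complex.I) ∂P := by
  have hint : ∀ X : Lp ℝ 2 P, Integrable (fun v => Complex.exp ((t * X v : ℝ) * Complex.I)) P := by
    intro X
    refine Integrable.of_bound (C := 1) ?_ (.of_forall fun v => ?_)
    · have := (Lp.aestronglyMeasurable X).const_mul t
      exact Complex.continuous_exp.comp_aestronglyMeasurable
        ((Complex.continuous_ofReal.comp_aestronglyMeasurable this).mul_const _)
    · rw [Complex.norm_exp_ofReal_mul_I]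
  refine (LipschitzWith.of_dist_le_mul (K := ⟨|t|, abs_nonneg t⟩) fun X Y => ?_).continuous
  rw [dist_eq_norm, dist_eq_norm, ← integral_sub (hint X) (hint Y)]
  have hXY : MemLp (X - Y : Lp ℝ 2 P) 2 P := Lp.memLp _
  calc ‖∫ v, (Complex.exp ((t * X v : ℝ) * Complex.I) - Complex.exp ((t * Y v : ℝ) * Complex.I)) ∂P‖
      ≤ ∫ v, |t| * ‖(X - Y : Lp ℝ 2 P) v‖ ∂P := by
        refine norm_integral_le_of_norm_le ((hXY.integrable (by norm_num)).norm.const_mul _) ?_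
        filter_upwards [Lp.coeFn_sub X Y] with v h
        refine (norm_exp_I_mul_sub_le _ _).trans_eq ?_
        rw [h, Pi.sub_apply, ← mul_sub, abs_mul, Real.norm_eq_abs]
    _ ≤ |t| * ‖X - Y‖ := by
        rw [integral_const_mul]
        refine mul_le_mul_of_nonneg_left ?_ (abs_nonneg t)
        rw [Lp.norm_def, integral_norm_eq_lintegral_enorm hXY.aestronglyMeasurable,
          ← eLpNorm_one_eq_lintegral_enorm]
        exact ENNReal.toReal_mono hXY.eLpNorm_ne_top
          (eLpNorm_le_eLpNorm_of_exponent_le (by norm_num) hXY.aestronglyMeasurable)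

lemma aemeasurable_paleyWiener {H Θ : Type*} [NormedAddCommGroup H] [InnerProductSpace ℝ H]
    [CompleteSpace H] [NormedAddCommGroup Θ] [NormedSpace ℝ Θ] [MeasurableSpace Θ] [BorelSpace Θ]
    {ι : H →L[ℝ] Θ} {W : Measure Θ} (h : H) : AEMeasurable (paleyWiener ι W h) W :=
  (Lp.aestronglyMeasurable _).aemeasurable

section Wiener

variable {H Θ : Type*} [NormedAddCommGroup H] [InnerProductSpace ℝ H] [CompleteSpace H]
  [NormedAddCommGroup Θ] [NormedSpace ℝ Θ] [CompleteSpace Θ]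
  [TopologicalSpace.SeparableSpace Θ] [MeasurableSpace Θ] [BorelSpace Θ]
  {ι : H →L[ℝ] Θ} {W : Measure Θ}

/-- The characteristic function of `𝓘(h)`, by density of the vectors `h_{x*}`. -/
lemma integral_exp_paleyWiener (hW : IsAbstractWienerSpace ι W) (h : H) (t : ℝ) :
    ∫ θ, Complex.exp ((t * paleyWiener ι W h θ : ℝ) * Complex.I) ∂W =
      Complex.exp (-((t ^ 2 * ‖h‖ ^ 2 / 2 : ℝ) : ℂ)) := by
  have := hW.isProbabilityMeasure
  refine (denseRange_dualRep hW.injective).induction_on (p := fun h =>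
    ∫ θ, Complex.exp ((t * paleyWiener ι W h θ : ℝ) * Complex.I) ∂W =
      Complex.exp (-((t ^ 2 * ‖h‖ ^ 2 / 2 : ℝ) : ℂ))) h (isClosed_eq ?_ ?_) fun L => ?_
  · exact (continuous_integral_exp_I_mul t).comp (paleyWiener ι W).continuous
  · fun_prop
  · have h1 := hW.integral_exp (t • L)
    rw [map_smul, norm_smul, mul_pow, Real.norm_eq_abs, sq_abs] at h1
    rw [← h1]
    refine integral_congr_ae ?_
    filter_upwards [hW.paleyWiener_dualRep L] with θ hθ
    rw [hθ, mul_comm]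
    simp

/-- The Paley-Wiener integral of `h` is a centered Gaussian variable of variance `‖h‖²`. -/
lemma map_paleyWiener (hW : IsAbstractWienerSpace ι W) (h : H) :
    W.map (paleyWiener ι W h) = gaussianReal 0 (‖h‖₊ ^ 2) := by
  have := hW.isProbabilityMeasure
  have hm := aemeasurable_paleyWiener (ι := ι) (W := W) h
  have : IsProbabilityMeasure (W.map (paleyWiener ι W h)) := Measure.isProbabilityMeasure_map hm
  refine Measure.ext_of_charFun ?_
  ext t
  rw [charFun_gaussianReal, charFun_apply_real, integral_map hm (by fun_prop)]
  refine Eq.trans (integral_congr_ae (.of_forall fun θ => ?_))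
    ((integral_exp_paleyWiener hW h t).trans ?_)
  · simp
  · congr 1
    push_cast
    simp
    ring

lemma integral_paleyWiener (hW : IsAbstractWienerSpace ι W) (h : H) :
    ∫ θ, paleyWiener ι W h θ ∂W = 0 := by
  have h1 := integral_map (aemeasurable_paleyWiener (ι := ι) (W := W) h)
    (f := fun t : ℝ => t) (by fun_prop)
  rw [← h1, map_paleyWiener hW, integral_id_gaussianReal]

lemma integral_paleyWiener_mul (hW : IsAbstractWienerSpace ι W) (h k : H) :
    ∫ θ, paleyWiener ι W h θ * paleyWiener ι W k θ ∂W = inner ℝ h k := by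
  have h1 : inner ℝ (paleyWiener ι W h) (paleyWiener ι W k) = inner ℝ h k :=
    LinearIsometry.inner_map_map ⟨(paleyWiener ι W).toLinearMap, hW.norm_paleyWiener⟩ h k
  rw [← h1, L2.inner_def]
  refine integral_congr_ae (.of_forall fun θ => ?_)
  simp only [RCLike.inner_apply, conj_trivial, mul_comm]

/-- The Paley-Wiener integrals form a Gaussian process indexed by `H`. -/
lemma isGaussianProcess_paleyWiener (hW : IsAbstractWienerSpace ι W) :
    IsGaussianProcess (fun (h : H) (θ : Θ) => paleyWiener ι W h θ) W where
  hasGaussianLaw I := by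
    have := hW.isProbabilityMeasure
    have hm : AEMeasurable (fun θ => I.restrict fun h => paleyWiener ι W h θ) W :=
      aemeasurable_pi_lambda _ fun h => aemeasurable_paleyWiener h.1
    refine ⟨isGaussian_of_map_eq_gaussianReal fun L => ?_⟩
    obtain ⟨c, hc⟩ : ∃ c : I → ℝ, ∀ v, L v = ∑ i, c i * v i := by
      classical
      refine ⟨fun i => L fun j => if i = j then 1 else 0, fun v => ?_⟩
      refine (LinearMap.pi_apply_eq_sum_univ L.toLinearMap v).trans ?_
      simp only [smul_eq_mul, mul_comm]
      rfl
    -- a linear form in finitely many integrals is the integral of a linear combination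
    refine ⟨0, ‖∑ i : I, c i • (i : H)‖₊ ^ 2, ?_⟩
    rw [← map_paleyWiener hW, AEMeasurable.map_map_of_aemeasurable (by fun_prop) hm]
    refine Measure.map_congr ?_
    have e1 : ∀ i : I, ∀ᵐ θ ∂W, (c i • paleyWiener ι W (i : H)) θ =
        c i * paleyWiener ι W (i : H) θ := fun i => Lp.coeFn_smul _ _
    simp only [map_sum, map_smul]
    filter_upwards [Lp.coeFn_fun_finsetSum Finset.univ
      fun i : I => c i • paleyWiener ι W (i : H), ae_all_iff.2 e1] with θ h1 h2
    rw [h1, Function.comp_apply, hc]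
    simp only [h2, Finset.restrict]

/-- The increment `𝓘(k) - 𝓘(h)` is independent of the `σ`-algebra generated by those `𝓘(g t)`
whose indices `g t` are orthogonal to `k - h`. -/
lemma indep_paleyWiener_sub (hW : IsAbstractWienerSpace ι W) {T : Type*} (S : Set T) (g : T → H)
    (h k : H) (hort : ∀ t ∈ S, inner ℝ k (g t) = inner ℝ h (g t)) :
    Indep
      (MeasurableSpace.comap (fun θ => paleyWiener ι W k θ - paleyWiener ι W h θ) inferInstance)
      (⨆ t ∈ S, MeasurableSpace.comap (fun θ => paleyWiener ι W (g t) θ) inferInstance) W := by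
  have := hW.isProbabilityMeasure
  let X : Unit → Θ → ℝ := fun _ θ => paleyWiener ι W k θ - paleyWiener ι W h θ
  let Y : S → Θ → ℝ := fun t θ => paleyWiener ι W (g t) θ
  have hG : IsGaussianProcess (Sum.elim X Y) W := by
    refine ((isGaussianProcess_paleyWiener hW).comp_right
      (Sum.elim (fun _ : Unit => k - h) fun t : S => g t)).congr ?_
    rintro (_ | t)
    · simp only [Function.comp_apply, Sum.elim_inl, map_sub]
      exact Lp.coeFn_sub _ _
    · rfl
  have hmem : ∀ f : H, MemLp (fun θ => paleyWiener ι W f θ) 2 W := fun f => Lp.memLp _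
  have hind := hG.indepFun_of_covariance_eq_zero
    (fun _ => (aemeasurable_paleyWiener k).sub (aemeasurable_paleyWiener h))
    (fun t => aemeasurable_paleyWiener (g t)) fun _ t => by
      have e := covariance_sub_left (hmem k) (hmem h) (hmem (g t))
      refine e.trans ?_
      rw [covariance_eq_sub (hmem _) (hmem _), covariance_eq_sub (hmem _) (hmem _)]
      simp only [Pi.mul_apply, integral_paleyWiener hW, integral_paleyWiener_mul hW,
        hort t t.2, sub_self]
  rw [IndepFun_iff_Indep] at hind
  convert hind using 1
  · simp only [MeasurableSpace.pi, MeasurableSpace.comap_comp, iSup_unique]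
    rfl
  · simp only [MeasurableSpace.pi, MeasurableSpace.comap_iSup, MeasurableSpace.comap_comp,
      iSup_subtype']
    rfl

end Wiener

end GFF

end

theorem theorem2p2 {Θ : Type*} [NormedAddCommGroup Θ] [NormedSpace ℝ Θ] [CompleteSpace Θ]
    [TopologicalSpace.SeparableSpace Θ] [MeasurableSpace Θ] [BorelSpace Θ]
    (ι : H2 →L[ℝ] Θ) (W : Measure Θ) (hW : IsAbstractWienerSpace ι W) :
    -- `G` maps `(0, ∞)` to `(0, ∞)`
    (∀ r : ℝ, 0 < r → 0 < G r) ∧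
    -- `μ^x_ε ∈ H⁻²`, so that `h_{μ^x_ε}` is well defined
    (∀ (x : E4) (ε : ℝ), 0 < ε → MemHNegTwo (muDist x ε)) ∧
    -- the family `𝓘(h_{μ^x_ε})`, `x ∈ ℝ⁴`, `ε > 0`, is a centered Gaussian family
    IsGaussianProcess (fun (p : E4 × Set.Ioi (0 : ℝ)) (θ : Θ) => muField ι W p.1 p.2 θ) W ∧
    (∀ (x : E4) (ε : ℝ), 0 < ε → ∫ θ, muField ι W x ε θ ∂W = 0) ∧
    -- (1) the concentric case
    (∀ (x : E4) (ε₁ ε₂ : ℝ), 0 < ε₂ → ε₂ ≤ ε₁ →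
      ∫ θ, muField ι W x ε₁ θ * muField ι W x ε₂ θ ∂W =
        ∫ θ, (muField ι W x ε₁ θ) ^ 2 ∂W ∧
      ∫ θ, (muField ι W x ε₁ θ) ^ 2 ∂W = G ε₁ ∧
      Indep
        (MeasurableSpace.comap
          (fun θ => muField ι W x ε₂ θ - muField ι W x ε₁ θ) inferInstance)
        (⨆ η ∈ Set.Ici ε₁, MeasurableSpace.comap (fun θ => muField ι W x η θ) inferInstance) W) ∧
    -- (2) the case of nested balls
    (∀ (x y : E4) (ε₁ ε₂ : ℝ), x ≠ y → 0 < ε₁ → 0 < ε₂ → ‖x - y‖ + ε₂ < ε₁ →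
      ∫ θ, muField ι W x ε₁ θ * muField ι W y ε₂ θ ∂W =
        besselI 0 ‖x - y‖ * G ε₁ -
          (1 / (4 * π ^ 2)) *
            (besselI 2 ‖x - y‖ / (besselI 1 ε₁ ^ 2 - besselI 0 ε₁ * besselI 2 ε₁))) ∧
    -- (3) the case of disjoint balls
    (∀ (x y : E4) (ε₁ ε₂ : ℝ), x ≠ y → 0 < ε₁ → 0 < ε₂ → ε₁ + ε₂ < ‖x - y‖ →
      ∫ θ, muField ι W x ε₁ θ * muField ι W y ε₂ θ ∂W =
        (1 / (2 * π ^ 2)) * besselK 0 ‖x - y‖) := by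
  have hcov : ∀ (x y : E4) {ε₁ ε₂ : ℝ}, 0 < ε₁ → 0 < ε₂ →
      ∫ θ, muField ι W x ε₁ θ * muField ι W y ε₂ θ ∂W =
        ∫ z, density x ε₁ z * density y ε₂ z := fun x y ε₁ ε₂ h₁ h₂ =>
    (integral_paleyWiener_mul hW _ _).trans (inner_hRep_muDist x y h₁ h₂)
  have hconc : ∀ (x : E4) (ε₁ ε₂ : ℝ), 0 < ε₂ → ε₂ ≤ ε₁ →
      ∫ θ, muField ι W x ε₁ θ * muField ι W x ε₂ θ ∂W = G ε₁ := fun x ε₁ ε₂ h₂ h =>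
    (hcov x x (h₂.trans_le h) h₂).trans (integral_density_mul_density_concentric x h₂ h)
  have hsq : ∀ (x : E4) (ε : ℝ), 0 < ε → ∫ θ, (muField ι W x ε θ) ^ 2 ∂W = G ε :=
    fun x ε hε => by simpa only [sq] using hconc x ε ε hε le_rfl
  refine ⟨fun r hr => G_pos hr, fun x ε hε => memHNegTwo_muDist x hε,
    (isGaussianProcess_paleyWiener hW).comp_right
      fun p : E4 × Set.Ioi (0 : ℝ) => hRep (muDist p.1 p.2),
    fun x ε _ => integral_paleyWiener hW _, fun x ε₁ ε₂ h₂ h => ⟨?_, ?_, ?_⟩,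
    fun x y ε₁ ε₂ hxy h₁ h₂ h => ?_, fun x y ε₁ ε₂ hxy h₁ h₂ h => ?_⟩
  · rw [hconc x ε₁ ε₂ h₂ h, hsq x ε₁ (h₂.trans_le h)]
  · exact hsq x ε₁ (h₂.trans_le h)
  · refine indep_paleyWiener_sub hW (Set.Ici ε₁) (fun η => hRep (muDist x η)) _ _ fun η hη => ?_
    have hη' : ε₁ ≤ η := hη
    have h₁ := h₂.trans_le h
    have h₀ := h₁.trans_le hη'
    rw [inner_hRep_muDist x x h₂ h₀, inner_hRep_muDist x x h₁ h₀]
    simp only [mul_comm (density x ε₂ _), mul_comm (density x ε₁ _)]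
    rw [integral_density_mul_density_concentric x h₂ (h.trans hη'),
      integral_density_mul_density_concentric x h₁ hη']
  · rw [hcov x y h₁ h₂, integral_density_mul_density_nested hxy h₁ h₂ h, turanI]
  · rw [hcov x y h₁ h₂, integral_density_mul_density_disjoint hxy h₁ h₂ h]
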